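/- A hypergraph $H=(X,(s_i)_{i\in I})$ consists of a finite vertex set $X$, a finite index set $I$ and hyperedges $s_i\subseteq X$ ($i\in I$), where repeated and empty hyperedges are allowed. A Roman hitting set (rhs) of $H$ is a pair $(R_1,R_2)$ with $R_1\subseteq I$ and $R_2\subseteq X$ such that for each $i\in I$ we have $i\in R_1$ or $s_i\cap R_2\neq\emptyset$; it is minimal if no other rhs $(P_1,P_2)$ satisfies $P_1\subseteq R_1$ and $P_2\subseteq R_2$. Write $n=|X|$ and $m=|I|$. (1) There is an algorithm (one program for a random access machine) that, given any hypergraph $H$ by its incidence matrix, outputs every minimal rhs of $H$ exactly once, outputs nothing else, and halts, and that satisfies the following bounds, where $p,q,r$ are fixed polynomials: the total running time is at most $p(n+m)\cdot 3^{(n+m)/3}$, i.e. $\mathcal{O}^*(3^{(n+m)/3})$; the delay, i.e. the time before the first output, between any two consecutive outputs, and between the last output and termination, is at most $q(n+m)$; and at every moment at most $r(n+m)$ bits of memory are in use (not counting the write-only output). (2) The bound in (1) is tight: for every $k\in\mathbb{N}$ there is a hypergraph with $n=2k$ vertices and $m=k$ hyperedges that has exactly $3^{(n+m)/3}=3^k$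 minimal rhs; hence every program that outputs all minimal rhs of this hypergraph, each exactly once, takes at least $3^{(n+m)/3}$ steps on it. -/

import Mathlib

/-- A finite hypergraph with vertex type `X` and hyperedges indexed by `I`; the same hyperedge may
occur under several indices, and a hyperedge may be empty. -/
structure IndexedHypergraph (X I : Type) where
  edge : I → Finset X

namespace IndexedHypergraph

variable {X I : Type}

/-- `R = (R₁, R₂)` is a Roman hitting set: every index lies in `R₁` or its hyperedge meets `R₂`. -/
def IsRomanHittingSet (H : IndexedHypergraph X I) (R : Finset I × Finset X) : Prop :=
  ∀ i : I, (∃ x ∈ H.edge i, x ∈ R.2) ∨ i ∈ R.1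

/-- Minimality with respect to componentwise inclusion (the product order on pairs of finsets). -/
def IsMinimalRomanHittingSet (H : IndexedHypergraph X I) (R : Finset I × Finset X) : Prop :=
  Minimal H.IsRomanHittingSet R

end IndexedHypergraph

/-! ### Random access machines with an output stream -/

namespace RAM

/-- Instructions. The machine has registers (directly addressed) and a memory (addressed through
registers), both holding natural numbers. It can only append to its output. -/
inductive Instr where
  /-- `reg d := k` -/
  | const (d k : ℕ)
  /-- `reg d := reg a + reg b` -/
  | add (d a b : ℕ)
  /-- `reg d := reg a - reg b`, and `0` if this is negative -/
  | sub (d a b : ℕ)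
  /-- `reg d := mem (reg a)` -/
  | load (d a : ℕ)
  /-- `mem (reg a) := reg b` -/
  | store (a b : ℕ)
  /-- continue at instruction `l` if `reg a = 0` -/
  | jumpZero (a l : ℕ)
  /-- append `reg a` to the output word that is being written -/
  | write (a : ℕ)
  /-- finish the output word that is being written, thereby outputting it, and start a new one -/
  | emit

/-- A program is a finite list of instructions; it does not depend on the input. -/
abbrev Program := List Instr

structure Config where
  /-- program counter -/
  pc : ℕ
  reg : ℕ → ℕ
  mem : ℕ → ℕ
  /-- the output word that is being written -/
  word : List ℕ
  /-- the words output so far, in chronological order -/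
  out : List (List ℕ)

def exec (c : Config) : Instr → Config
  | .const d k => { c with pc := c.pc + 1, reg := Function.update c.reg d k }
  | .add d a b => { c with pc := c.pc + 1, reg := Function.update c.reg d (c.reg a + c.reg b) }
  | .sub d a b => { c with pc := c.pc + 1, reg := Function.update c.reg d (c.reg a - c.reg b) }
  | .load d a => { c with pc := c.pc + 1, reg := Function.update c.reg d (c.mem (c.reg a)) }
  | .store a b => { c with pc := c.pc + 1, mem := Function.update c.mem (c.reg a) (c.reg b) }
  | .jumpZero a l => { c with pc := if c.reg a = 0 then l else c.pc + 1 }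
  | .write a => { c with pc := c.pc + 1, word := c.word ++ [c.reg a] }
  | .emit => { c with pc := c.pc + 1, word := [], out := c.out ++ [c.word] }

/-- One step; the machine has halted when the program counter points beyond the program. -/
def step (P : Program) (c : Config) : Config :=
  match P[c.pc]? with
  | none => c
  | some ins => exec c ins

/-- The configuration after `t` steps. Every instruction counts as one step; together with a bound
on the number of bits held during the run, this bounds the bit cost of the run as well. -/
def run (P : Program) (c : Config) (t : ℕ) : Config :=
  (step P)^[t] c

def Halted (P : Program) (c : Config) : Prop :=
  P.length ≤ c.pc

/-- The machine started in `c` halts after exactly `T` steps. -/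
def HaltsAt (P : Program) (c : Config) (T : ℕ) : Prop :=
  Halted P (run P c T) ∧ ∀ t < T, ¬ Halted P (run P c t)

/-- The nonzero entries of the array `f`, listed as pairs of an address and a content in binary,
take at most `b` bits (with one further bit charged for each pair). -/
def BitsLE (f : ℕ → ℕ) (b : ℕ) : Prop :=
  ∃ s : Finset ℕ, (∀ a ∉ s, f a = 0) ∧ ∑ a ∈ s, (Nat.size a + Nat.size (f a) + 1) ≤ b

/-- Registers and memory together (which include the input) hold at most `b` bits. As usual, the
write-only output is not charged. -/
def SpaceLE (c : Config) (b : ℕ) : Prop :=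
  ∃ b₁ b₂ : ℕ, BitsLE c.reg b₁ ∧ BitsLE c.mem b₂ ∧ b₁ + b₂ ≤ b

end RAM

/-! ### Programs that enumerate minimal Roman hitting sets -/

namespace RomanEnum

open RAM

variable {n m : ℕ}

/-- Input: `n` and `m` in the first two registers, and the incidence matrix, row by row, in the
first `m * n` memory cells; everything else is `0`. -/
def start (H : IndexedHypergraph (Fin n) (Fin m)) : Config where
  pc := 0
  reg := fun r => if r = 0 then n else if r = 1 then m else 0
  mem := fun a => if ∃ (i : Fin m) (x : Fin n), a = i * n + x ∧ x ∈ H.edge i then 1 else 0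
  word := []
  out := []

/-- A pair `(R₁, R₂)` is output as the characteristic vector of `R₁` followed by that of `R₂`. -/
def encode (R : Finset (Fin m) × Finset (Fin n)) : List ℕ :=
  List.ofFn (fun i : Fin m => if i ∈ R.1 then 1 else 0) ++
    List.ofFn (fun x : Fin n => if x ∈ R.2 then 1 else 0)

/-- On input `H` the program halts after exactly `T` steps, and its output consists of all minimal
Roman hitting sets of `H`, each of them exactly once, and nothing else. -/
def EnumeratesInTime (P : Program) (H : IndexedHypergraph (Fin n) (Fin m)) (T : ℕ) : Prop :=
  HaltsAt P (start H) T ∧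
    (run P (start H) T).out.Nodup ∧
    ∀ w : List ℕ, w ∈ (run P (start H) T).out ↔
      ∃ R : Finset (Fin m) × Finset (Fin n), H.IsMinimalRomanHittingSet R ∧ w = encode R

/-- In a run of `T` steps, at any moment before halting, the next output or the end of the run is
at most `d` steps away. This bounds the time before the first output, between two consecutive
outputs, and between the last output and the end. -/
def DelayLE (P : Program) (H : IndexedHypergraph (Fin n) (Fin m)) (T d : ℕ) : Prop :=
  ∀ t < T, T ≤ t + d ∨ (run P (start H) t).out.length < (run P (start H) (t + d)).out.length

end RomanEnum

/-!
In a minimal rhs `(R₁, R₂)` the set `R₁` consists of the hyperedges missed by `R₂`, so `R₂`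
determines the rhs, and the sets `R₂` that occur are those in which every vertex `x` is irredundant:
some hyperedge meets `R₂` in `x` only.

Subsets of irredundant sets are irredundant. Hence the colexicographic successor of an irredundant
set `S` is `{v} ∪ {x ∈ S | x > v}`, where `v ∉ S` is the first vertex for which this set is
irredundant, and the irredundant sets can be enumerated with polynomial delay, remembering only the
current set.

That at most `3 ^ ((n + m) / 3)` sets are irredundant is shown by branching: either a vertex `x` is
left out, or `x` and a private hyperedge of `x` are removed together with the other vertices of that
hyperedge and with the other hyperedges through `x`, according to the degrees that occur.
-/


namespace IndexedHypergraph

open Finset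

variable {X I : Type} [DecidableEq X] {H : IndexedHypergraph X I} {V : Finset X} {E : Finset I}

/-- `S` is irredundant with respect to the hyperedges indexed by `E`: every vertex of `S` has a
private hyperedge, one that meets `S` in this vertex only. -/
def IsIrredundant (H : IndexedHypergraph X I) (E : Finset I) (S : Finset X) : Prop :=
  ∀ x ∈ S, ∃ i ∈ E, H.edge i ∩ S = {x}

open Classical in
/-- The irredundant subsets of `V` with respect to the hyperedges indexed by `E`. -/
noncomputable def irredundantSets (H : IndexedHypergraph X I) (V : Finset X) (E : Finset I) :
    Finset (Finset X) :=
  {S ∈ V.powerset | H.IsIrredundant E S}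

/-- The indices in `E` of the hyperedges that contain the vertex `x`. -/
def incident (H : IndexedHypergraph X I) (E : Finset I) (x : X) : Finset I :=
  {i ∈ E | x ∈ H.edge i}

theorem mem_irredundantSets {S : Finset X} :
    S ∈ H.irredundantSets V E ↔ S ⊆ V ∧ H.IsIrredundant E S := by
  simp [irredundantSets]

theorem mem_incident {x : X} {i : I} : i ∈ H.incident E x ↔ i ∈ E ∧ x ∈ H.edge i := by
  simp [incident]

theorem incident_subset (H : IndexedHypergraph X I) (E : Finset I) (x : X) :
    H.incident E x ⊆ E :=
  filter_subset _ _

theorem isIrredundant_empty (H : IndexedHypergraph X I) (E : Finset I) : H.IsIrredundant E ∅ :=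
  fun _ hx => absurd hx (notMem_empty _)

theorem mem_of_inter_eq_singleton {α : Type*} [DecidableEq α] {s t : Finset α} {a : α}
    (h : s ∩ t = {a}) : a ∈ s ∧ a ∈ t :=
  mem_inter.1 (h ▸ mem_singleton_self a)

theorem inter_eq_singleton_iff {α : Type*} [DecidableEq α] {s t : Finset α} {a : α} (ha : a ∈ t) :
    s ∩ t = {a} ↔ a ∈ s ∧ #(s ∩ t) ≤ 1 := by
  constructor
  · intro h
    exact ⟨(mem_of_inter_eq_singleton h).1, (card_eq_one.2 ⟨a, h⟩).le⟩
  · rintro ⟨hs, hcard⟩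
    have hmem := mem_inter.2 ⟨hs, ha⟩
    exact eq_singleton_iff_unique_mem.2 ⟨hmem, fun b hb => card_le_one.1 hcard b hb a hmem⟩

theorem IsIrredundant.subset {S T : Finset X} (hS : H.IsIrredundant E S) (hT : T ⊆ S) :
    H.IsIrredundant E T := by
  intro x hx
  obtain ⟨i, hi, h⟩ := hS x (hT hx)
  refine ⟨i, hi, Subset.antisymm ?_ ?_⟩
  · exact h ▸ inter_subset_inter_left hT
  · exact singleton_subset_iff.2 (mem_inter.2 ⟨(mem_of_inter_eq_singleton h).1, hx⟩)

theorem notMem_or_exists_private {S : Finset X} (hS : S ∈ H.irredundantSets V E) (x : X) :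
    x ∉ S ∨ ∃ i ∈ H.incident E x, H.edge i ∩ S = {x} := by
  by_cases hx : x ∈ S
  · obtain ⟨i, hi, h⟩ := (mem_irredundantSets.1 hS).2 x hx
    exact Or.inr ⟨i, mem_incident.2 ⟨hi, (mem_of_inter_eq_singleton h).1⟩, h⟩
  · exact Or.inl hx

theorem edge_inter_eq_of_subset {S : Finset X} (hS : S ⊆ V) (i : I) :
    H.edge i ∩ S = S ∩ (H.edge i ∩ V) := by
  rw [inter_left_comm, inter_eq_left.2 hS]

/-- A set with trace `K` on `A` is determined by its part outside `A`, where the hyperedges that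
meet `K`, or lie inside `A`, are private for no vertex. -/
theorem card_filter_inter_eq_le [DecidableEq I] {A K : Finset X} {D : Finset I}
    (hD : ∀ i ∈ D, (∃ x ∈ K, x ∈ H.edge i) ∨ H.edge i ∩ V ⊆ A) :
    #{S ∈ H.irredundantSets V E | S ∩ A = K} ≤ #(H.irredundantSets (V \ A) (E \ D)) := by
  refine card_le_card_of_injOn (· \ A) ?_ ?_
  · intro S hS
    obtain ⟨hS, hSA⟩ := mem_filter.1 hS
    obtain ⟨hSV, hS⟩ := mem_irredundantSets.1 hS
    refine mem_irredundantSets.2 ⟨sdiff_subset_sdiff hSV le_rfl, fun x hx => ?_⟩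
    obtain ⟨hxS, hxA⟩ := mem_sdiff.1 hx
    obtain ⟨i, hi, h⟩ := hS x hxS
    refine ⟨i, mem_sdiff.2 ⟨hi, fun hiD => hxA ?_⟩, ?_⟩
    · rcases hD i hiD with ⟨y, hyK, hyi⟩ | hsub
      · obtain ⟨hyS, hyA⟩ := mem_inter.1 (hSA.symm ▸ hyK)
        have hyx : y = x := mem_singleton.1 (h ▸ mem_inter.2 ⟨hyi, hyS⟩)
        exact hyx ▸ hyA
      · exact hsub (mem_inter.2 ⟨(mem_of_inter_eq_singleton h).1, hSV hxS⟩)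
    · rw [← inter_sdiff_assoc, h, sdiff_eq_self_of_disjoint (disjoint_singleton_left.2 hxA)]
  · intro S hS T hT hST
    rw [← sdiff_union_inter S A, ← sdiff_union_inter T A, (mem_filter.1 hS).2,
      (mem_filter.1 hT).2]
    exact congrArg (· ∪ K) hST

/-- The cube root of three. -/
noncomputable def cbrtThree : ℝ := (3 : ℝ) ^ ((1 : ℝ) / 3)

theorem cbrtThree_pow (k : ℕ) : cbrtThree ^ k = (3 : ℝ) ^ ((k : ℝ) / 3) := by
  rw [cbrtThree, ← Real.rpow_mul_natCast (by norm_num), one_div_mul_eq_div]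

theorem one_le_cbrtThree : 1 ≤ cbrtThree :=
  Real.one_le_rpow (by norm_num) (by norm_num)

theorem cbrtThree_pos : 0 < cbrtThree :=
  zero_lt_one.trans_le one_le_cbrtThree

theorem inv_cbrtThree_pos : 0 < cbrtThree⁻¹ :=
  inv_pos.2 cbrtThree_pos

theorem inv_cbrtThree_pow_three : cbrtThree⁻¹ ^ 3 = 1 / 3 := by
  rw [inv_pow, cbrtThree_pow]
  norm_num

theorem inv_cbrtThree_lt : cbrtThree⁻¹ < 0.6934 := by
  by_contra! h
  have h3 := pow_le_pow_left₀ (by norm_num) h 3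
  rw [inv_cbrtThree_pow_three] at h3
  norm_num at h3

open Classical in
/-- The irredundant subsets of `V` that satisfy `p` are at most a fraction `w` of the bound
`3 ^ ((|V| + |E|) / 3)`. -/
def FractionLE (H : IndexedHypergraph X I) (V : Finset X) (E : Finset I)
    (p : Finset X → Prop) (w : ℝ) : Prop :=
  (#{S ∈ H.irredundantSets V E | p S} : ℝ) ≤ w * cbrtThree ^ (#V + #E)

/-- There are at most `3 ^ ((|V| + |E|) / 3)` irredundant subsets of `V`. -/
def CardBound (H : IndexedHypergraph X I) (V : Finset X) (E : Finset I) : Prop :=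
  (#(H.irredundantSets V E) : ℝ) ≤ cbrtThree ^ (#V + #E)

/-- The induction hypothesis: the bound holds for all smaller vertex and index sets. -/
def CardBoundBelow (H : IndexedHypergraph X I) (V : Finset X) (E : Finset I) : Prop :=
  ∀ (V' : Finset X) (E' : Finset I), #V' + #E' < #V + #E → H.CardBound V' E'

namespace FractionLE

variable {p q : Finset X → Prop} {a b w : ℝ}

theorem or (hp : H.FractionLE V E p a) (hq : H.FractionLE V E q b) :
    H.FractionLE V E (fun S => p S ∨ q S) (a + b) := by
  classical
  have hcard : #{S ∈ H.irredundantSets V E | p S ∨ q S} ≤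
      #{S ∈ H.irredundantSets V E | p S} + #{S ∈ H.irredundantSets V E | q S} := by
    rw [filter_or]
    exact card_union_le _ _
  rw [FractionLE, add_mul]
  refine le_trans (Nat.cast_le.2 ?_) ((Nat.cast_add _ _).trans_le (add_le_add hp hq))
  convert hcard

theorem of_forall_not (h : ∀ S ∈ H.irredundantSets V E, ¬ p S) (hw : 0 ≤ w) :
    H.FractionLE V E p w := by
  classical
  rw [FractionLE, filter_false_of_mem h, card_empty, Nat.cast_zero]
  exact mul_nonneg hw (pow_pos cbrtThree_pos _).le

theorem mono (hq : H.FractionLE V E q a) (hpq : ∀ S ∈ H.irredundantSets V E, p S → q S)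
    (hab : a ≤ b) : H.FractionLE V E p b := by
  classical
  have hsub : #{S ∈ H.irredundantSets V E | p S} ≤ #{S ∈ H.irredundantSets V E | q S} :=
    card_le_card fun S hS =>
      mem_filter.2 ⟨(mem_filter.1 hS).1, hpq S (mem_filter.1 hS).1 (mem_filter.1 hS).2⟩
  refine (Nat.cast_le.2 ?_).trans
    (hq.trans (mul_le_mul_of_nonneg_right hab (pow_pos cbrtThree_pos _).le))
  convert hsub

theorem pow_anti {k l : ℕ} (hp : H.FractionLE V E p (cbrtThree⁻¹ ^ k)) (hkl : l ≤ k) :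
    H.FractionLE V E p (cbrtThree⁻¹ ^ l) :=
  hp.mono (fun _ _ => id)
    (pow_le_pow_of_le_one inv_cbrtThree_pos.le (inv_le_one_of_one_le₀ one_le_cbrtThree) hkl)

theorem cardBound (hp : H.FractionLE V E p w) (h : ∀ S ∈ H.irredundantSets V E, p S)
    (hw : w ≤ 1) : H.CardBound V E := by
  have hle := hp.mono (p := fun _ => True) (fun S hS _ => h S hS) hw
  simpa only [FractionLE, CardBound, filter_true, one_mul] using hle

end FractionLE

namespace CardBoundBelow

theorem fractionLE_inter_eq (ih : H.CardBoundBelow V E) {A K : Finset X} {D : Finset I}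
    (hA : A ⊆ V) (hDE : D ⊆ E) (hpos : 0 < #A + #D)
    (hD : ∀ i ∈ D, (∃ x ∈ K, x ∈ H.edge i) ∨ H.edge i ∩ V ⊆ A) :
    H.FractionLE V E (fun S => S ∩ A = K) (cbrtThree⁻¹ ^ (#A + #D)) := by
  classical
  have hV := card_sdiff_add_card_eq_card hA
  have hE := card_sdiff_add_card_eq_card hDE
  have hsplit : cbrtThree⁻¹ ^ (#A + #D) * cbrtThree ^ (#V + #E) =
      cbrtThree ^ (#(V \ A) + #(E \ D)) := by
    rw [← hV, ← hE, add_add_add_comm, pow_add cbrtThree, inv_pow, mul_comm,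
      mul_inv_cancel_right₀ (pow_pos cbrtThree_pos _).ne']
  refine (Nat.cast_le.2 ?_).trans ((ih (V \ A) (E \ D) (by omega)).trans hsplit.ge)
  convert card_filter_inter_eq_le hD

theorem fractionLE_notMem (ih : H.CardBoundBelow V E) {x : X} (hx : x ∈ V) :
    H.FractionLE V E (x ∉ ·) cbrtThree⁻¹ := by
  have h := ih.fractionLE_inter_eq (A := {x}) (K := ∅) (D := ∅) (by simpa using hx)
    (empty_subset _) (by simp) (by simp)
  refine h.mono (fun S _ hxS => ?_) (by simp)
  exact disjoint_iff_inter_eq_empty.1 (disjoint_singleton_right.2 hxS)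

theorem fractionLE_mem (ih : H.CardBoundBelow V E) {x : X} (hx : x ∈ V) :
    H.FractionLE V E (x ∈ ·) (cbrtThree⁻¹ ^ (1 + #(H.incident E x))) := by
  have h := ih.fractionLE_inter_eq (A := {x}) (K := {x}) (D := H.incident E x)
    (by simpa using hx) (H.incident_subset E x) (by simp)
    fun i hi => Or.inl ⟨x, mem_singleton_self x, (mem_incident.1 hi).2⟩
  exact h.mono (fun S _ hxS => inter_singleton_of_mem hxS) (by simp)

theorem fractionLE_edge_inter_eq_empty (ih : H.CardBoundBelow V E) {i : I} (hi : i ∈ E) :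
    H.FractionLE V E (H.edge i ∩ · = ∅) (cbrtThree⁻¹ ^ (#(H.edge i ∩ V) + 1)) := by
  have h := ih.fractionLE_inter_eq (A := H.edge i ∩ V) (K := ∅) (D := {i})
    inter_subset_right (by simpa using hi) (by simp) (by simp)
  refine h.mono (fun S hS hiS => ?_) (by simp)
  rw [← edge_inter_eq_of_subset (mem_irredundantSets.1 hS).1, hiS]

theorem fractionLE_private (ih : H.CardBoundBelow V E) {i : I} {x : X}
    (hx : x ∈ H.edge i ∩ V) :
    H.FractionLE V E (H.edge i ∩ · = {x})
      (cbrtThree⁻¹ ^ (#(H.edge i ∩ V) + #(H.incident E x))) := by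
  have h := ih.fractionLE_inter_eq (A := H.edge i ∩ V) (K := {x}) (D := H.incident E x)
    inter_subset_right (H.incident_subset E x) (Nat.add_pos_left (card_pos.2 ⟨x, hx⟩) _)
    fun j hj => Or.inl ⟨x, mem_singleton_self x, (mem_incident.1 hj).2⟩
  refine h.mono (fun S hS hiS => ?_) le_rfl
  rw [← edge_inter_eq_of_subset (mem_irredundantSets.1 hS).1, hiS]

theorem fractionLE_mem_and_mem (ih : H.CardBoundBelow V E) {x y : X} (hx : x ∈ V) (hy : y ∈ V)
    (hxy : x ≠ y) :
    H.FractionLE V E (fun S => x ∈ S ∧ y ∈ S) (cbrtThree⁻¹ ^ (3 + #(H.incident E x))) := by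
  classical
  by_cases hsub : H.incident E y ⊆ H.incident E x
  · have hnone : ∀ S ∈ H.irredundantSets V E, ¬ (x ∈ S ∧ y ∈ S) := by
      rintro S hS ⟨hxS, hyS⟩
      obtain ⟨i, hi, h⟩ := (notMem_or_exists_private hS y).resolve_left (not_not.2 hyS)
      have hxi := (mem_incident.1 (hsub hi)).2
      exact hxy (mem_singleton.1 (h ▸ mem_inter.2 ⟨hxi, hxS⟩))
    exact FractionLE.of_forall_not hnone (pow_pos inv_cbrtThree_pos _).le
  · have h := ih.fractionLE_inter_eq (A := {x, y}) (K := {x, y})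
      (D := H.incident E x ∪ H.incident E y) (by simp [insert_subset_iff, hx, hy])
      (union_subset (H.incident_subset E x) (H.incident_subset E y)) (by simp) (by
        intro i hi
        rcases mem_union.1 hi with hi | hi
        · exact Or.inl ⟨x, by simp, (mem_incident.1 hi).2⟩
        · exact Or.inl ⟨y, by simp, (mem_incident.1 hi).2⟩)
    have hlt : #(H.incident E x) < #(H.incident E x ∪ H.incident E y) :=
      card_lt_card (left_lt_sup.2 hsub)
    rw [card_pair hxy] at h
    refine (h.pow_anti (by omega)).mono (fun S _ ⟨hxS, hyS⟩ => ?_) le_rfl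
    exact inter_eq_right.2 (by simp [insert_subset_iff, hxS, hyS])

theorem cardBound_of_degree_eq_zero (ih : H.CardBoundBelow V E) {x : X} (hx : x ∈ V)
    (hdeg : #(H.incident E x) = 0) : H.CardBound V E := by
  refine (ih.fractionLE_notMem hx).cardBound (fun S hS => ?_)
    (inv_le_one_of_one_le₀ one_le_cbrtThree)
  have h := notMem_or_exists_private hS x
  rw [card_eq_zero.1 hdeg] at h
  simpa using h

theorem cardBound_of_three_le_degree (ih : H.CardBoundBelow V E) {x : X} (hx : x ∈ V)
    (hdeg : 3 ≤ #(H.incident E x)) : H.CardBound V E := by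
  have hmem := (ih.fractionLE_mem hx).pow_anti (l := 4) (by omega)
  refine ((ih.fractionLE_notMem hx).or hmem).cardBound (fun S _ => (em (x ∈ S)).symm) ?_
  rw [pow_succ _ 3, inv_cbrtThree_pow_three]
  linarith [inv_cbrtThree_lt]

theorem cardBound_of_card_edge_le_one (ih : H.CardBoundBelow V E) {i : I} (hi : i ∈ E)
    (hcard : #(H.edge i ∩ V) ≤ 1) : H.CardBound V E := by
  have hempty := ih.fractionLE_edge_inter_eq_empty hi
  rcases Nat.le_one_iff_eq_zero_or_eq_one.1 hcard with h0 | h1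
  · refine hempty.cardBound (fun S hS => ?_)
      (pow_le_one₀ inv_cbrtThree_pos.le (inv_le_one_of_one_le₀ one_le_cbrtThree))
    rw [edge_inter_eq_of_subset (mem_irredundantSets.1 hS).1, card_eq_zero.1 h0, inter_empty]
  · obtain ⟨x, hx⟩ := card_eq_one.1 h1
    have hxi := mem_of_inter_eq_singleton hx
    have hdeg : 0 < #(H.incident E x) := card_pos.2 ⟨i, mem_incident.2 ⟨hi, hxi.1⟩⟩
    have hmem := (ih.fractionLE_mem hxi.2).pow_anti (l := 2) (by omega)
    rw [h1] at hempty
    refine (hempty.or hmem).cardBound (fun S hS => ?_) ?_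
    · rw [edge_inter_eq_of_subset (mem_irredundantSets.1 hS).1, hx,
        ← disjoint_iff_inter_eq_empty, disjoint_singleton_right]
      exact (em (x ∈ S)).symm
    · nlinarith [inv_cbrtThree_lt, inv_cbrtThree_pos]

theorem cardBound_of_degree_eq_one (ih : H.CardBoundBelow V E) {x : X} (hx : x ∈ V)
    (hdeg : #(H.incident E x) = 1) : H.CardBound V E := by
  obtain ⟨i, hinc⟩ := card_eq_one.1 hdeg
  obtain ⟨hi, hxi⟩ := mem_incident.1 (hinc.symm ▸ mem_singleton_self i)
  have hxV : x ∈ H.edge i ∩ V := mem_inter.2 ⟨hxi, hx⟩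
  have hcover : ∀ S ∈ H.irredundantSets V E, x ∉ S ∨ H.edge i ∩ S = {x} := fun S hS => by
    simpa [hinc] using notMem_or_exists_private hS x
  have hpriv := ih.fractionLE_private (E := E) hxV
  rw [hdeg] at hpriv
  rcases Nat.lt_trichotomy #(H.edge i ∩ V) 2 with h1 | h2 | h3
  · exact ih.cardBound_of_card_edge_le_one hi (by omega)
  · obtain ⟨y, hy⟩ := card_eq_one.1 (show #((H.edge i ∩ V).erase x) = 1 by
      rw [card_erase_of_mem hxV, h2])
    have hyV : y ∈ H.edge i ∩ V := mem_of_mem_erase (hy.symm ▸ mem_singleton_self y)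
    have hy_deg : 0 < #(H.incident E y) :=
      card_pos.2 ⟨i, mem_incident.2 ⟨hi, (mem_inter.1 hyV).1⟩⟩
    have hempty := (ih.fractionLE_edge_inter_eq_empty hi).pow_anti (l := 3) (by omega)
    have hpriv_y := (ih.fractionLE_private hyV).pow_anti (l := 3) (by omega)
    refine ((hpriv.pow_anti (l := 3) (by omega)).or (hempty.or hpriv_y)).cardBound
      (fun S hS => ?_) (by rw [inv_cbrtThree_pow_three]; norm_num)
    refine (hcover S hS).symm.imp_right fun hxS => ?_
    rw [edge_inter_eq_of_subset (mem_irredundantSets.1 hS).1, ← subset_singleton_iff, ← hy]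
    exact fun z hz => mem_erase.2 ⟨fun hzx => hxS (hzx ▸ (mem_inter.1 hz).1), (mem_inter.1 hz).2⟩
  · refine ((ih.fractionLE_notMem hx).or (hpriv.pow_anti (l := 4) (by omega))).cardBound hcover ?_
    rw [pow_succ _ 3, inv_cbrtThree_pow_three]
    linarith [inv_cbrtThree_lt]

theorem fractionLE_of_edge_eq_pair (ih : H.CardBoundBelow V E) {i : I} (hi : i ∈ E) {x y : X}
    (hxy : x ≠ y) (hedge : H.edge i ∩ V = {x, y}) (hx : #(H.incident E x) = 2)
    (hy : #(H.incident E y) = 2) : H.FractionLE V E (fun _ => True) 0.957 := by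
  have hxi : x ∈ H.edge i ∩ V := by simp [hedge]
  have hyi : y ∈ H.edge i ∩ V := by simp [hedge]
  have hcard : #(H.edge i ∩ V) = 2 := by rw [hedge, card_pair hxy]
  have hempty := ih.fractionLE_edge_inter_eq_empty hi
  have hpriv_x := ih.fractionLE_private hxi
  have hpriv_y := ih.fractionLE_private hyi
  have hboth := ih.fractionLE_mem_and_mem (mem_inter.1 hxi).2 (mem_inter.1 hyi).2 hxy
  rw [hcard] at hempty
  rw [hcard, hx] at hpriv_x
  rw [hcard, hy] at hpriv_y
  rw [hx] at hboth
  refine (hempty.or (hpriv_x.or (hpriv_y.or hboth))).mono (fun S hS _ => ?_) ?_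
  · rw [edge_inter_eq_of_subset (mem_irredundantSets.1 hS).1, hedge]
    by_cases hxS : x ∈ S <;> by_cases hyS : y ∈ S <;>
      simp [hxS, hyS, inter_insert_of_mem, inter_insert_of_notMem]
  · have hβ := inv_cbrtThree_lt
    have hβ0 := inv_cbrtThree_pos
    have hfactor : cbrtThree⁻¹ ^ (2 + 1) + (cbrtThree⁻¹ ^ (2 + 2) +
        (cbrtThree⁻¹ ^ (2 + 2) + cbrtThree⁻¹ ^ (3 + 2))) =
          cbrtThree⁻¹ ^ 3 * (1 + cbrtThree⁻¹) ^ 2 := by ring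
    rw [hfactor, inv_cbrtThree_pow_three]
    nlinarith

theorem fractionLE_notMem_of_erase {x : X} (hx : x ∈ V) {w : ℝ}
    (h : H.FractionLE (V.erase x) E (fun _ => True) w) :
    H.FractionLE V E (x ∉ ·) (w * cbrtThree⁻¹) := by
  classical
  have hinj : #{S ∈ H.irredundantSets V E | x ∉ S} ≤ #(H.irredundantSets (V.erase x) E) := by
    refine card_le_card fun S hS => ?_
    obtain ⟨hS, hxS⟩ := mem_filter.1 hS
    obtain ⟨hSV, hirr⟩ := mem_irredundantSets.1 hS
    exact mem_irredundantSets.2 ⟨subset_erase.2 ⟨hSV, hxS⟩, hirr⟩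
  have hpow : cbrtThree⁻¹ * cbrtThree ^ (#V + #E) = cbrtThree ^ (#(V.erase x) + #E) := by
    rw [← card_erase_add_one hx, add_right_comm, pow_succ', inv_mul_cancel_left₀ cbrtThree_pos.ne']
  rw [FractionLE, filter_true, ← hpow, ← mul_assoc] at h
  refine (Nat.cast_le.2 ?_).trans h
  convert hinj

theorem fractionLE_private_of_degree_eq_two (ih : H.CardBoundBelow V E) {i : I} {x : X}
    (hx : x ∈ H.edge i ∩ V) (hdeg : #(H.incident E x) = 2) {k : ℕ} (hk : k ≤ #(H.edge i ∩ V)) :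
    H.FractionLE V E (H.edge i ∩ · = {x}) (cbrtThree⁻¹ ^ (k + 2)) :=
  (ih.fractionLE_private hx).pow_anti (by omega)

/-- Deleting `x`, which lies in the hyperedges `i` and `j` only, leaves two vertices of `i`, so the
estimate for a hyperedge with two vertices applies to the remaining instance. -/
theorem cardBound_of_card_edge_eq_three (ih : H.CardBoundBelow V E) {i j : I} {x : X} (hx : x ∈ V)
    (hinc : ∀ k, k ∈ H.incident E x ↔ k = i ∨ k = j)
    (hdeg : ∀ y ∈ V, #(H.incident E y) = 2)
    (hi : #(H.edge i ∩ V) = 3) (hj : 3 ≤ #(H.edge j ∩ V)) : H.CardBound V E := by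
  obtain ⟨hiE, hxi⟩ := mem_incident.1 ((hinc i).2 (Or.inl rfl))
  obtain ⟨-, hxj⟩ := mem_incident.1 ((hinc j).2 (Or.inr rfl))
  have hxV : x ∈ H.edge i ∩ V := mem_inter.2 ⟨hxi, hx⟩
  obtain ⟨y, z, hyz, hedge⟩ := card_eq_two.1 (show #((H.edge i ∩ V).erase x) = 2 by
    rw [card_erase_of_mem hxV, hi])
  have hsub : {y, z} ⊆ V := hedge ▸ (erase_subset _ _).trans inter_subset_right
  have ih_erase : H.CardBoundBelow (V.erase x) E := fun V' E' h =>
    ih V' E' (h.trans (Nat.add_lt_add_right (card_erase_lt_of_mem hx) _))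
  have hnotMem := fractionLE_notMem_of_erase hx (ih_erase.fractionLE_of_edge_eq_pair hiE hyz
    (by rw [← hedge, inter_erase]) (hdeg y (hsub (by simp))) (hdeg z (hsub (by simp))))
  have hpriv_i := ih.fractionLE_private_of_degree_eq_two hxV (hdeg x hx) hi.ge
  have hpriv_j := ih.fractionLE_private_of_degree_eq_two (mem_inter.2 ⟨hxj, hx⟩) (hdeg x hx) hj
  refine (hnotMem.or (hpriv_i.or hpriv_j)).cardBound (fun S hS => ?_) ?_
  · simpa [hinc] using notMem_or_exists_private hS x
  · rw [pow_add, inv_cbrtThree_pow_three]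
    nlinarith [inv_cbrtThree_lt, inv_cbrtThree_pos]

theorem cardBound_of_four_le_card_edge (ih : H.CardBoundBelow V E) {i j : I} {x : X} (hx : x ∈ V)
    (hinc : ∀ k, k ∈ H.incident E x ↔ k = i ∨ k = j) (hdeg : #(H.incident E x) = 2)
    (hi : 4 ≤ #(H.edge i ∩ V)) (hj : 3 ≤ #(H.edge j ∩ V)) : H.CardBound V E := by
  obtain ⟨-, hxi⟩ := mem_incident.1 ((hinc i).2 (Or.inl rfl))
  obtain ⟨-, hxj⟩ := mem_incident.1 ((hinc j).2 (Or.inr rfl))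
  have hpriv_i := ih.fractionLE_private_of_degree_eq_two (mem_inter.2 ⟨hxi, hx⟩) hdeg hi
  have hpriv_j := ih.fractionLE_private_of_degree_eq_two (mem_inter.2 ⟨hxj, hx⟩) hdeg hj
  refine ((ih.fractionLE_notMem hx).or (hpriv_i.or hpriv_j)).cardBound (fun S hS => ?_) ?_
  · simpa [hinc] using notMem_or_exists_private hS x
  · rw [show 4 + 2 = 3 + 3 from rfl, pow_add, pow_add, inv_cbrtThree_pow_three]
    nlinarith [inv_cbrtThree_lt, inv_cbrtThree_pos]

theorem cardBound_of_degree_eq_two (ih : H.CardBoundBelow V E) (hV : V.Nonempty)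
    (hdeg : ∀ x ∈ V, #(H.incident E x) = 2) (hcard : ∀ i ∈ E, 2 ≤ #(H.edge i ∩ V)) :
    H.CardBound V E := by
  by_cases hpair : ∃ i ∈ E, #(H.edge i ∩ V) = 2
  · obtain ⟨i, hi, h2⟩ := hpair
    obtain ⟨x, y, hxy, hedge⟩ := card_eq_two.1 h2
    have hsub : {x, y} ⊆ V := hedge ▸ inter_subset_right
    exact (ih.fractionLE_of_edge_eq_pair hi hxy hedge (hdeg x (hsub (by simp)))
      (hdeg y (hsub (by simp)))).cardBound (fun _ _ => trivial) (by norm_num)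
  push Not at hpair
  have hcard3 : ∀ i ∈ E, 3 ≤ #(H.edge i ∩ V) := fun i hi =>
    lt_of_le_of_ne (hcard i hi) (hpair i hi).symm
  obtain ⟨x, hx⟩ := hV
  classical
  obtain ⟨i, j, -, hij⟩ := card_eq_two.1 (hdeg x hx)
  have hinc : ∀ k, k ∈ H.incident E x ↔ k = i ∨ k = j := by simp [hij]
  have hi := hcard3 i (mem_incident.1 ((hinc i).2 (Or.inl rfl))).1
  have hj := hcard3 j (mem_incident.1 ((hinc j).2 (Or.inr rfl))).1
  rcases hi.eq_or_lt with h3 | h4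
  · exact ih.cardBound_of_card_edge_eq_three hx hinc hdeg h3.symm hj
  · exact ih.cardBound_of_four_le_card_edge hx hinc (hdeg x hx) h4 hj

end CardBoundBelow

theorem cardBound (H : IndexedHypergraph X I) (V : Finset X) (E : Finset I) :
    H.CardBound V E := by
  induction hN : #V + #E using Nat.strong_induction_on generalizing V E with
  | _ N ihN =>
    have ih : H.CardBoundBelow V E := fun V' E' h => ihN _ (hN ▸ h) V' E' rfl
    rcases V.eq_empty_or_nonempty with rfl | hV
    · classical
      have hone : #(H.irredundantSets ∅ E) ≤ 1 := card_filter_le {∅} _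
      exact (Nat.cast_le_one.2 hone).trans (one_le_pow₀ one_le_cbrtThree)
    by_cases hcard : ∃ i ∈ E, #(H.edge i ∩ V) ≤ 1
    · obtain ⟨i, hi, h⟩ := hcard
      exact ih.cardBound_of_card_edge_le_one hi h
    by_cases hdeg : ∃ x ∈ V, #(H.incident E x) ≠ 2
    · obtain ⟨x, hx, h⟩ := hdeg
      rcases (by omega :
          #(H.incident E x) = 0 ∨ #(H.incident E x) = 1 ∨ 3 ≤ #(H.incident E x)) with
        h0 | h1 | h3
      · exact ih.cardBound_of_degree_eq_zero hx h0
      · exact ih.cardBound_of_degree_eq_one hx h1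
      · exact ih.cardBound_of_three_le_degree hx h3
    push Not at hcard hdeg
    exact ih.cardBound_of_degree_eq_two hV hdeg hcard

end IndexedHypergraph

namespace IndexedHypergraph

open Finset

section Minimal

variable {X I : Type} [DecidableEq X] {H : IndexedHypergraph X I}

theorem IsRomanHittingSet.exists_private {R : Finset I × Finset X} {x : X}
    (hR : H.IsRomanHittingSet R) (hx : ¬ H.IsRomanHittingSet (R.1, R.2.erase x)) :
    ∃ i, H.edge i ∩ R.2 = {x} := by
  obtain ⟨i, hi⟩ := not_forall.1 hx
  obtain ⟨hno, hi⟩ := not_or.1 hi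
  obtain ⟨y, hyi, hy⟩ := (hR i).resolve_right hi
  have huniq : ∀ z ∈ H.edge i, z ∈ R.2 → z = x := fun z hzi hz =>
    by_contra fun hne => hno ⟨z, hzi, mem_erase.2 ⟨hne, hz⟩⟩
  refine ⟨i, eq_singleton_iff_unique_mem.2 ⟨?_, fun z hz => ?_⟩⟩
  · exact huniq y hyi hy ▸ mem_inter.2 ⟨hyi, hy⟩
  · exact huniq z (mem_inter.1 hz).1 (mem_inter.1 hz).2

variable [Fintype I]

/-- The indices of the hyperedges that do not meet `S`. -/
def unhit (H : IndexedHypergraph X I) (S : Finset X) : Finset I :=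
  {i | H.edge i ∩ S = ∅}

theorem mem_unhit {S : Finset X} {i : I} : i ∈ H.unhit S ↔ H.edge i ∩ S = ∅ := by
  simp [unhit]

theorem isRomanHittingSet_iff_unhit_subset {R : Finset I × Finset X} :
    H.IsRomanHittingSet R ↔ H.unhit R.2 ⊆ R.1 := by
  refine forall_congr' fun i => ?_
  rw [mem_unhit, ← not_nonempty_iff_eq_empty, or_iff_not_imp_left]
  simp only [Finset.Nonempty, mem_inter]

theorem isMinimalRomanHittingSet_iff {R : Finset I × Finset X} :
    H.IsMinimalRomanHittingSet R ↔ H.IsIrredundant univ R.2 ∧ R.1 = H.unhit R.2 := by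
  constructor
  · rintro ⟨hR, hmin⟩
    have hunhit := isRomanHittingSet_iff_unhit_subset.1 hR
    refine ⟨fun x hx => ?_, ?_⟩
    · obtain ⟨i, hi⟩ := hR.exists_private fun hrhs =>
        notMem_erase x R.2 ((hmin hrhs ⟨le_rfl, erase_subset x R.2⟩).2 hx)
      exact ⟨i, mem_univ i, hi⟩
    · have hrhs : H.IsRomanHittingSet (H.unhit R.2, R.2) :=
        isRomanHittingSet_iff_unhit_subset.2 Subset.rfl
      exact Subset.antisymm (hmin hrhs ⟨hunhit, le_rfl⟩).1 hunhit
  · rintro ⟨hirr, hR⟩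
    refine ⟨isRomanHittingSet_iff_unhit_subset.2 hR.ge, fun Q hQ hQR => ?_⟩
    have hsub : R.2 ⊆ Q.2 := by
      intro x hx
      obtain ⟨i, -, hi⟩ := hirr x hx
      have hiR : i ∉ R.1 := by
        rw [hR, mem_unhit, hi]
        exact singleton_ne_empty x
      obtain ⟨y, hyi, hy⟩ := (hQ i).resolve_right fun h => hiR (hQR.1 h)
      have hyx : y = x := mem_singleton.1 (hi ▸ mem_inter.2 ⟨hyi, hQR.2 hy⟩)
      exact hyx ▸ hy
    refine ⟨?_, hsub⟩
    rw [hR, Subset.antisymm hsub hQR.2]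
    exact isRomanHittingSet_iff_unhit_subset.1 hQ

theorem ncard_setOf_isMinimalRomanHittingSet [Fintype X] (H : IndexedHypergraph X I) :
    {R | H.IsMinimalRomanHittingSet R}.ncard = #(H.irredundantSets univ univ) := by
  have himage : {R | H.IsMinimalRomanHittingSet R} =
      (fun S => (H.unhit S, S)) '' (H.irredundantSets univ univ : Set (Finset X)) := by
    ext ⟨R₁, R₂⟩
    simp [isMinimalRomanHittingSet_iff, mem_irredundantSets, eq_comm]
  rw [himage, Set.ncard_image_of_injective _ fun S T h => congrArg Prod.snd h,
    Set.ncard_coe_finset]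

end Minimal

section Colex

variable {X I : Type} [LinearOrder X] {H : IndexedHypergraph X I} {E : Finset I} {S T : Finset X}
  {v : X}

/-- The set that agrees with `S` above `v`, contains `v`, and has no elements below `v`. It is the
least set above `S` in the colexicographic order whose highest difference from `S` is at `v`. -/
def candidate (S : Finset X) (v : X) : Finset X :=
  insert v {x ∈ S | v < x}

/-- The position `v` can be added to `S` if all smaller elements are dropped. The successor of an
irredundant set in the colexicographic order comes from its least pivot. -/
def IsPivot (H : IndexedHypergraph X I) (E : Finset I) (S : Finset X) (v : X) : Prop :=
  v ∉ S ∧ H.IsIrredundant E (candidate S v)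

theorem toColex_lt_candidate (hv : v ∉ S) : toColex S < toColex (candidate S v) := by
  refine Colex.lt_iff_exists_filter_lt.2 ⟨v, by simp [candidate, hv], ?_⟩
  simp [candidate, filter_insert, filter_filter]

theorem candidate_subset (hv : v ∈ T) (h : {x ∈ S | v < x} = {x ∈ T | v < x}) :
    candidate S v ⊆ T := by
  rw [candidate, h]
  exact insert_subset hv (filter_subset _ _)

theorem candidate_lt_of_lt {u : X} (hvS : v ∉ S) (hvT : v ∈ T)
    (h : {x ∈ S | v < x} = {x ∈ T | v < x}) (huv : u < v) :
    toColex (candidate S u) < toColex T := by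
  refine Colex.lt_iff_exists_filter_lt.2 ⟨v, by simp [candidate, hvT, hvS, huv.ne'], ?_⟩
  rw [← h, candidate, filter_insert, if_neg huv.not_gt, filter_filter]
  exact filter_congr fun x _ => and_iff_right_of_imp huv.trans

theorem exists_isPivot_of_toColex_lt (hT : H.IsIrredundant E T) (hST : toColex S < toColex T) :
    ∃ v, H.IsPivot E S v ∧ ∀ u ≤ v, toColex (candidate S u) ≤ toColex T := by
  obtain ⟨v, hv, h⟩ := Colex.lt_iff_exists_filter_lt.1 hST
  obtain ⟨hvT, hvS⟩ := mem_sdiff.1 hv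
  have hsub := candidate_subset hvT h
  refine ⟨v, ⟨hvS, hT.subset hsub⟩, fun u hu => ?_⟩
  rcases hu.eq_or_lt with rfl | hu
  · exact Colex.toColex_mono hsub
  · exact (candidate_lt_of_lt hvS hvT h hu).le

theorem IsPivot.isLeast_toColex_candidate (hv : H.IsPivot E S v)
    (hmin : ∀ u < v, ¬ H.IsPivot E S u) :
    IsLeast {T | H.IsIrredundant E (ofColex T) ∧ toColex S < T} (toColex (candidate S v)) := by
  refine ⟨⟨hv.2, toColex_lt_candidate hv.1⟩, fun T hT => ?_⟩
  obtain ⟨w, hw, hle⟩ := exists_isPivot_of_toColex_lt hT.1 hT.2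
  exact hle v (le_of_not_gt fun hwv => hmin w hwv hw)

end Colex

end IndexedHypergraph

namespace RAM

variable {P : Program} {c : Config}

theorem run_add (P : Program) (c : Config) (s t : ℕ) :
    run P c (s + t) = run P (run P c s) t := by
  rw [run, add_comm, Function.iterate_add_apply, run, run]

theorem run_succ (P : Program) (c : Config) (t : ℕ) : run P c (t + 1) = step P (run P c t) :=
  Function.iterate_succ_apply' _ _ _

theorem run_one (P : Program) (c : Config) : run P c 1 = step P c :=
  rfl

theorem step_of_halted (h : Halted P c) : step P c = c := by
  rw [step, List.getElem?_eq_none h]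

theorem step_of_getElem? {ins : Instr} (h : P[c.pc]? = some ins) : step P c = exec c ins := by
  rw [step, h]

theorem run_of_halted (h : Halted P c) (t : ℕ) : run P c t = c :=
  Function.iterate_fixed (step_of_halted h) t

theorem out_length_step (P : Program) (c : Config) :
    c.out.length ≤ (step P c).out.length ∧ (step P c).out.length ≤ c.out.length + 1 := by
  unfold step
  split
  · simp
  · rename_i ins _
    cases ins <;> simp [exec]

theorem monotone_out_length (P : Program) (c : Config) :
    Monotone fun t => (run P c t).out.length :=
  monotone_nat_of_le_succ fun t => by
    rw [run_succ]
    exact (out_length_step P _).1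

theorem out_length_run_le (P : Program) (c : Config) (t : ℕ) :
    (run P c t).out.length ≤ c.out.length + t := by
  induction t with
  | zero => exact le_rfl
  | succ t ih =>
    rw [run_succ]
    exact (out_length_step P _).2.trans (Nat.succ_le_succ ih)

theorem exists_haltsAt_of_halted {t : ℕ} (h : Halted P (run P c t)) :
    ∃ T ≤ t, HaltsAt P c T ∧ run P c T = run P c t := by
  classical
  have hex : ∃ t, Halted P (run P c t) := ⟨t, h⟩
  obtain ⟨e, he⟩ := Nat.exists_eq_add_of_le (Nat.find_min' hex h)
  refine ⟨Nat.find hex, Nat.find_min' hex h, ⟨Nat.find_spec hex, fun _ => Nat.find_min hex⟩, ?_⟩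
  rw [he, run_add, run_of_halted (Nat.find_spec hex)]

/-- If exactly one word is output in each of the first `N` periods of `d` steps, then any `2 * d`
consecutive steps contain a whole period. -/
theorem out_length_lt_of_periodic {d N : ℕ} (hd : 0 < d)
    (hlen : ∀ k ≤ N, (run P c (k * d)).out.length = k) (t : ℕ) :
    N * d ≤ t + 2 * d ∨ (run P c t).out.length < (run P c (t + 2 * d)).out.length := by
  have hdiv : d * (t / d) + t % d = t := Nat.div_add_mod t d
  have hmod : t % d < d := Nat.mod_lt t hd
  have hsucc : (t / d + 1) * d = d * (t / d) + d := by ring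
  have hsucc2 : (t / d + 2) * d = d * (t / d) + 2 * d := by ring
  rcases Nat.lt_or_ge N (t / d + 2) with hN | hN
  · have hle : N * d ≤ (t / d + 2) * d := Nat.mul_le_mul_right d hN.le
    exact Or.inl (by omega)
  · refine Or.inr ?_
    calc (run P c t).out.length ≤ (run P c ((t / d + 1) * d)).out.length :=
          monotone_out_length P c (by omega)
      _ = t / d + 1 := hlen _ (by omega)
      _ < t / d + 2 := Nat.lt_succ_self _
      _ = (run P c ((t / d + 2) * d)).out.length := (hlen _ hN).symm
      _ ≤ (run P c (t + 2 * d)).out.length := monotone_out_length P c (by omega)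

/-- At most `N` entries of the array `f` are nonzero, and their addresses and contents have at most
`b` bits. -/
def SizeLE (f : ℕ → ℕ) (N b : ℕ) : Prop :=
  ∃ s : Finset ℕ, s.card ≤ N ∧ (∀ a ∈ s, a < 2 ^ b) ∧ (∀ a ∉ s, f a = 0) ∧ ∀ a, f a < 2 ^ b

namespace SizeLE

variable {f : ℕ → ℕ} {N N' b b' : ℕ}

theorem apply_lt (h : SizeLE f N b) (a : ℕ) : f a < 2 ^ b :=
  h.choose_spec.2.2.2 a

theorem mono (h : SizeLE f N b) (hN : N ≤ N') (hb : b ≤ b') : SizeLE f N' b' := by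
  obtain ⟨s, hcard, haddr, hzero, hval⟩ := h
  have hpow : 2 ^ b ≤ 2 ^ b' := Nat.pow_le_pow_right two_pos hb
  exact ⟨s, hcard.trans hN, fun a ha => (haddr a ha).trans_le hpow, hzero,
    fun a => (hval a).trans_le hpow⟩

theorem update {a v : ℕ} (h : SizeLE f N b) (ha : a < 2 ^ b) (hv : v < 2 ^ b) :
    SizeLE (Function.update f a v) (N + 1) b := by
  obtain ⟨s, hcard, haddr, hzero, hval⟩ := h
  refine ⟨insert a s, (Finset.card_insert_le _ _).trans (Nat.succ_le_succ hcard), ?_, ?_, ?_⟩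
  · exact (Finset.forall_mem_insert _ _ _).2 ⟨ha, haddr⟩
  · intro x hx
    rw [Finset.mem_insert, not_or] at hx
    rw [Function.update_of_ne hx.1, hzero x hx.2]
  · intro x
    rw [Function.update_apply]
    split_ifs
    exacts [hv, hval x]

theorem bitsLE (h : SizeLE f N b) : BitsLE f (N * (2 * b + 1)) := by
  obtain ⟨s, hcard, haddr, hzero, hval⟩ := h
  refine ⟨s, hzero, ?_⟩
  calc ∑ a ∈ s, (Nat.size a + Nat.size (f a) + 1) ≤ ∑ _a ∈ s, (2 * b + 1) := by
        refine Finset.sum_le_sum fun a ha => ?_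
        have haddr_size := Nat.size_le.2 (haddr a ha)
        have hval_size := Nat.size_le.2 (hval a)
        omega
    _ = s.card * (2 * b + 1) := by rw [Finset.sum_const, smul_eq_mul]
    _ ≤ N * (2 * b + 1) := Nat.mul_le_mul_right _ hcard

end SizeLE

/-- A bound for the numbers in the text of the instruction that can end up as the address of a
nonzero register or as the content of a register. -/
def Instr.literal : Instr → ℕ
  | .const d k => d + k
  | .add d _ _ | .sub d _ _ | .load d _ => d
  | .store _ _ | .jumpZero _ _ | .write _ | .emit => 0

theorem exists_forall_literal_lt (P : Program) : ∃ b, ∀ i ∈ P, i.literal < 2 ^ b :=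
  ⟨(P.map Instr.literal).sum, fun _ hi =>
    (List.single_le_sum (fun _ _ => Nat.zero_le _) _ (List.mem_map_of_mem hi)).trans_lt
      Nat.lt_two_pow_self⟩

/-- Registers and memory both have at most `N` nonzero entries, with addresses and contents of at
most `b` bits. -/
def Config.SizeLE (c : Config) (N b : ℕ) : Prop :=
  RAM.SizeLE c.reg N b ∧ RAM.SizeLE c.mem N b

theorem Config.SizeLE.spaceLE {N b : ℕ} (h : c.SizeLE N b) :
    SpaceLE c (2 * (N * (2 * b + 1))) :=
  ⟨_, _, h.1.bitsLE, h.2.bitsLE, (two_mul _).ge⟩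

theorem Config.SizeLE.exec {N b : ℕ} (h : c.SizeLE N b) {i : Instr} (hi : i.literal < 2 ^ b) :
    (exec c i).SizeLE (N + 1) (b + 1) := by
  have hreg := h.1.mono le_rfl b.le_succ
  have hmem := h.2.mono le_rfl b.le_succ
  have hreg' := h.1.mono N.le_succ b.le_succ
  have hmem' := h.2.mono N.le_succ b.le_succ
  cases i with simp only [Instr.literal] at hi
  | const d k => exact ⟨hreg.update (by omega) (by omega), hmem'⟩
  | add d x y =>
    have hx := h.1.apply_lt x
    have hy := h.1.apply_lt y
    exact ⟨hreg.update (by omega) (by omega), hmem'⟩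
  | sub d x y =>
    have hx := h.1.apply_lt x
    exact ⟨hreg.update (by omega) (by omega), hmem'⟩
  | load d x =>
    have hx := h.2.apply_lt (c.reg x)
    exact ⟨hreg.update (by omega) (by omega), hmem'⟩
  | store x y =>
    have hx := h.1.apply_lt x
    have hy := h.1.apply_lt y
    exact ⟨hreg', hmem.update (by omega) (by omega)⟩
  | jumpZero x l => exact ⟨hreg', hmem'⟩
  | write x => exact ⟨hreg', hmem'⟩
  | emit => exact ⟨hreg', hmem'⟩

theorem Config.SizeLE.run {N b : ℕ} (h : c.SizeLE N b) (hP : ∀ i ∈ P, i.literal < 2 ^ b) (t : ℕ) :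
    (run P c t).SizeLE (N + t) (b + t) := by
  induction t with
  | zero => exact h
  | succ t ih =>
    rw [run_succ, step]
    split
    · exact ⟨ih.1.mono (by omega) (by omega), ih.2.mono (by omega) (by omega)⟩
    · next i hi =>
      exact ih.exec ((hP i (List.mem_of_getElem? hi)).trans_le
        (Nat.pow_le_pow_right two_pos (Nat.le_add_right b t)))

theorem SpaceLE.mono {b b' : ℕ} (h : SpaceLE c b) (hb : b ≤ b') : SpaceLE c b' := by
  obtain ⟨b₁, b₂, hreg, hmem, hle⟩ := h
  exact ⟨b₁, b₂, hreg, hmem, hle.trans hb⟩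

end RAM

namespace LoopLang

open RAM Function

variable {ι ρ : Type}

/-- Arithmetic expressions over parameters from `ι`, which a program cannot change, and variables
from `ρ`. Subtraction is truncated, and `load a` is the content of the memory cell `a`. -/
inductive Expr (ι ρ : Type) where
  | const (k : ℕ)
  | param (i : ι)
  | var (x : ρ)
  | add (a b : Expr ι ρ)
  | sub (a b : Expr ι ρ)
  | load (a : Expr ι ρ)

instance : Add (Expr ι ρ) := ⟨.add⟩

instance : Sub (Expr ι ρ) := ⟨.sub⟩

/-- Structured programs. The command `loop x i c` executes `c` for `x = 0, 1, …, i - 1`; since it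
keeps its own counter, `c` may assign to `x` without affecting the number of iterations. -/
inductive Cmd (ι ρ : Type) where
  | assign (x : ρ) (e : Expr ι ρ)
  | store (a e : Expr ι ρ)
  | write (e : Expr ι ρ)
  | emit
  | seq (c d : Cmd ι ρ)
  | loop (x : ρ) (i : ι) (c : Cmd ι ρ)

instance : Append (Cmd ι ρ) := ⟨.seq⟩

/-- What a program can change: the variables, the memory, the word being written, and the output. -/
structure State (ρ : Type) where
  var : ρ → ℕ
  mem : ℕ → ℕ
  word : List ℕ
  out : List (List ℕ)

/-- The value of an expression, for the parameter values `p`. -/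
def Expr.eval (p : ι → ℕ) (s : State ρ) : Expr ι ρ → ℕ
  | .const k => k
  | .param i => p i
  | .var x => s.var x
  | .add a b => a.eval p s + b.eval p s
  | .sub a b => a.eval p s - b.eval p s
  | .load a => s.mem (a.eval p s)

@[simp]
theorem Expr.eval_sub (p : ι → ℕ) (s : State ρ) (a b : Expr ι ρ) :
    (a - b).eval p s = a.eval p s - b.eval p s :=
  rfl

namespace Cmd

section Semantics

variable [DecidableEq ρ] {p : ι → ℕ}

/-- The effect of a command, for the parameter values `p`. -/
def den (p : ι → ℕ) : Cmd ι ρ → State ρ → State ρ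
  | .assign x e, s => { s with var := update s.var x (e.eval p s) }
  | .store a e, s => { s with mem := update s.mem (a.eval p s) (e.eval p s) }
  | .write e, s => { s with word := s.word ++ [e.eval p s] }
  | .emit, s => { s with word := [], out := s.out ++ [s.word] }
  | .seq c d, s => d.den p (c.den p s)
  | .loop x i c, s =>
    (List.range (p i)).foldl (fun s j => c.den p { s with var := update s.var x j }) s

@[simp]
theorem den_append (c d : Cmd ι ρ) (s : State ρ) : (c ++ d).den p s = d.den p (c.den p s) :=
  rfl

/-- The variables that a command may change. -/
def writes : Cmd ι ρ → List ρ
  | .assign x _ => [x]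
  | .store _ _ | .write _ | .emit => []
  | .seq c d => c.writes ++ d.writes
  | .loop x _ c => x :: c.writes

/-- The command changes variables only. -/
def onlyAssigns : Cmd ι ρ → Bool
  | .assign _ _ => true
  | .store _ _ | .write _ | .emit => false
  | .seq c d => c.onlyAssigns && d.onlyAssigns
  | .loop _ _ c => c.onlyAssigns

theorem den_loop_induction {x : ρ} {i : ι} {c : Cmd ι ρ} {s : State ρ}
    (inv : ℕ → State ρ → Prop) (zero : inv 0 s)
    (succ : ∀ j e, inv j e → inv (j + 1) (c.den p { e with var := update e.var x j })) :
    inv (p i) ((loop x i c).den p s) := by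
  suffices h : ∀ k, inv k ((List.range k).foldl
      (fun s j => c.den p { s with var := update s.var x j }) s) from h (p i)
  intro k
  induction k with
  | zero => exact zero
  | succ k ih =>
    rw [List.range_succ, List.foldl_append]
    exact succ k _ ih

theorem var_den {x : ρ} {c : Cmd ι ρ} (hx : x ∉ c.writes) (s : State ρ) :
    (c.den p s).var x = s.var x := by
  induction c generalizing s with
  | assign y e => exact update_of_ne (by simpa [writes] using hx) _ _
  | store a e => rfl
  | write e => rfl
  | emit => rfl
  | seq c d ihc ihd =>
    rw [writes, List.mem_append, not_or] at hx
    rw [den, ihd hx.2, ihc hx.1]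
  | loop y i c ih =>
    rw [writes, List.mem_cons, not_or] at hx
    refine den_loop_induction (fun _ e => e.var x = s.var x) rfl fun j e he => ?_
    exact (ih hx.2 _).trans ((update_of_ne hx.1 _ _).trans he)

theorem den_of_onlyAssigns {c : Cmd ι ρ} (hc : c.onlyAssigns) (s : State ρ) :
    c.den p s = { s with var := (c.den p s).var } := by
  induction c generalizing s with
  | assign x e => rfl
  | store a e => simp [onlyAssigns] at hc
  | write e => simp [onlyAssigns] at hc
  | emit => simp [onlyAssigns] at hc
  | seq c d ihc ihd =>
    obtain ⟨hc, hd⟩ := Bool.and_eq_true_iff.1 hc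
    rw [den, ihd hd, ihc hc]
  | loop x i c ih =>
    refine den_loop_induction (fun _ e => e = { s with var := e.var }) rfl fun j e he => ?_
    rw [ih hc, he]

theorem mem_den {c : Cmd ι ρ} (hc : c.onlyAssigns) (s : State ρ) : (c.den p s).mem = s.mem := by
  rw [den_of_onlyAssigns hc]

theorem word_den {c : Cmd ι ρ} (hc : c.onlyAssigns) (s : State ρ) :
    (c.den p s).word = s.word := by
  rw [den_of_onlyAssigns hc]

theorem out_den {c : Cmd ι ρ} (hc : c.onlyAssigns) (s : State ρ) : (c.den p s).out = s.out := by
  rw [den_of_onlyAssigns hc]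

/-- The loop rule with the variables that the loop does not change added to the invariant. -/
theorem den_loop_induction_of_frame {x : ρ} {i : ι} {c : Cmd ι ρ} {s : State ρ}
    (inv : ℕ → State ρ → Prop) (zero : inv 0 s)
    (succ : ∀ j e, (∀ y, y ≠ x → y ∉ c.writes → e.var y = s.var y) → inv j e →
      inv (j + 1) (c.den p { e with var := update e.var x j })) :
    inv (p i) ((loop x i c).den p s) := by
  refine (den_loop_induction (fun j e =>
    (∀ y, y ≠ x → y ∉ c.writes → e.var y = s.var y) ∧ inv j e) ⟨fun _ _ _ => rfl, zero⟩ ?_).2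
  rintro j e ⟨hframe, hinv⟩
  refine ⟨fun y hyx hy => ?_, succ j e hframe hinv⟩
  exact (var_den hy _).trans ((update_of_ne hyx _ _).trans (hframe y hyx hy))

end Semantics

end Cmd

/-- An assignment of registers to the parameters, the variables and a stack of temporaries. -/
abbrev Layout (ι ρ : Type) := ι ⊕ ρ ⊕ ℕ ↪ ℕ

namespace Layout

variable (L : Layout ι ρ) (p : ι → ℕ) (v : ρ → ℕ) (σ : ℕ → ℕ)

/-- The register of a parameter. -/
def param (i : ι) : ℕ := L (.inl i)

/-- The register of a variable. -/
def var (x : ρ) : ℕ := L (.inr (.inl x))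

/-- The register of a temporary. -/
def temp (t : ℕ) : ℕ := L (.inr (.inr t))

/-- The registers that hold the parameters `p`, the variables `v` and the temporaries `σ`. -/
noncomputable def regs : ℕ → ℕ :=
  extend L (Sum.elim p (Sum.elim v σ)) 0

@[simp]
theorem regs_param (i : ι) : L.regs p v σ (L.param i) = p i :=
  L.injective.extend_apply _ _ _

@[simp]
theorem regs_var (x : ρ) : L.regs p v σ (L.var x) = v x :=
  L.injective.extend_apply _ _ _

@[simp]
theorem regs_temp (t : ℕ) : L.regs p v σ (L.temp t) = σ t :=
  L.injective.extend_apply _ _ _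

theorem update_extend {α : Type} [DecidableEq α] (f : α ↪ ℕ) (g : α → ℕ) (a : α) (k : ℕ) :
    update (extend f g 0) (f a) k = extend f (update g a k) 0 := by
  funext r
  by_cases hr : ∃ b, f b = r
  · obtain ⟨b, rfl⟩ := hr
    rw [f.injective.extend_apply]
    by_cases hb : b = a
    · rw [hb, update_self, update_self]
    · rw [update_of_ne (f.injective.ne hb), update_of_ne hb, f.injective.extend_apply]
  · rw [update_of_ne fun h => hr ⟨a, h.symm⟩, extend_apply' _ _ _ hr, extend_apply' _ _ _ hr]

@[simp]
theorem update_regs_var [DecidableEq ρ] (x : ρ) (k : ℕ) :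
    update (L.regs p v σ) (L.var x) k = L.regs p (update v x k) σ := by
  classical
  rw [regs, var, update_extend, regs, Sum.update_elim_inr, Sum.update_elim_inl]

@[simp]
theorem update_regs_temp (t k : ℕ) :
    update (L.regs p v σ) (L.temp t) k = L.regs p v (update σ t k) := by
  classical
  rw [regs, temp, update_extend, regs, Sum.update_elim_inr, Sum.update_elim_inr]

end Layout

/-- The configuration of the machine at instruction `l`. -/
noncomputable def State.toConfig (s : State ρ) (L : Layout ι ρ) (p : ι → ℕ) (σ : ℕ → ℕ) (l : ℕ) :
    Config :=
  ⟨l, L.regs p s.var σ, s.mem, s.word, s.out⟩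

/-- The code `Q` stands in `P` at address `l`. -/
def CodeAt (P : Program) (l : ℕ) (Q : Program) : Prop :=
  ∀ (j : ℕ) (hj : j < Q.length), P[l + j]? = some Q[j]

namespace CodeAt

variable {P Q R : Program} {l : ℕ}

theorem left (h : CodeAt P l (Q ++ R)) : CodeAt P l Q := by
  intro j hj
  rw [h j (by rw [List.length_append]; omega), List.getElem_append_left hj]

theorem right (h : CodeAt P l (Q ++ R)) : CodeAt P (l + Q.length) R := by
  intro j hj
  rw [add_assoc, h (Q.length + j) (by rw [List.length_append]; omega),
    List.getElem_append_right (Nat.le_add_right _ _)]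
  simp only [Nat.add_sub_cancel_left]

theorem head {i : Instr} (h : CodeAt P l (i :: Q)) : P[l]? = some i :=
  h 0 (Nat.succ_pos _)

theorem tail {i : Instr} (h : CodeAt P l (i :: Q)) : CodeAt P (l + 1) Q :=
  right (Q := [i]) h

theorem append_left (P R : Program) : CodeAt (P ++ R) 0 P := by
  intro j hj
  rw [zero_add, List.getElem?_append_left hj, List.getElem?_eq_getElem hj]

end CodeAt

/-- The instruction never jumps. -/
def IsStraight (i : Instr) : Prop :=
  ∀ a l, i ≠ .jumpZero a l

theorem pc_exec {c : Config} {i : Instr} (hi : IsStraight i) : (exec c i).pc = c.pc + 1 := by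
  cases i with
  | jumpZero a l => exact (hi a l rfl).elim
  | _ => rfl

theorem run_eq_foldl_exec {P Q : Program} {c : Config} (h : CodeAt P c.pc Q)
    (hQ : ∀ i ∈ Q, IsStraight i) : run P c Q.length = Q.foldl exec c := by
  induction Q generalizing c with
  | nil => rfl
  | cons i Q ih =>
    obtain ⟨hi, hQ⟩ := List.forall_mem_cons.1 hQ
    rw [List.length_cons, add_comm, run_add, run_one, step_of_getElem? h.head, List.foldl_cons]
    exact ih (pc_exec hi ▸ h.tail) hQ

/-- Code that leaves the value of the expression in the temporary `t`. It relies on the later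
temporaries being zero and restores them. -/
def Expr.compile (L : Layout ι ρ) : Expr ι ρ → ℕ → Program
  | .const k, t => [.const (L.temp t) k]
  | .param i, t => [.add (L.temp t) (L.param i) (L.temp (t + 1))]
  | .var x, t => [.add (L.temp t) (L.var x) (L.temp (t + 1))]
  | .add a b, t => a.compile L t ++ b.compile L (t + 1) ++
      [.add (L.temp t) (L.temp t) (L.temp (t + 1)), .const (L.temp (t + 1)) 0]
  | .sub a b, t => a.compile L t ++ b.compile L (t + 1) ++
      [.sub (L.temp t) (L.temp t) (L.temp (t + 1)), .const (L.temp (t + 1)) 0]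
  | .load a, t => a.compile L t ++ [.load (L.temp t) (L.temp t)]

/-- The length of the code of an expression. -/
def Expr.size : Expr ι ρ → ℕ
  | .const _ | .param _ | .var _ => 1
  | .add a b | .sub a b => a.size + b.size + 2
  | .load a => a.size + 1

@[simp]
theorem Expr.length_compile (L : Layout ι ρ) (e : Expr ι ρ) (t : ℕ) :
    (e.compile L t).length = e.size := by
  induction e generalizing t with
  | _ => simp [Expr.compile, Expr.size, add_assoc, *]

theorem Expr.isStraight_compile (L : Layout ι ρ) (e : Expr ι ρ) (t : ℕ) :
    ∀ i ∈ e.compile L t, IsStraight i := by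
  induction e generalizing t with
  | _ => grind [Expr.compile, IsStraight]

theorem update_pair_restore {σ : ℕ → ℕ} {t : ℕ} (hσ : σ (t + 1) = 0) (k k' v : ℕ) :
    update (update (update (update σ t k) (t + 1) k') t v) (t + 1) 0 = update σ t v := by
  rw [update_comm t.succ_ne_self, update_idem, update_idem, update_eq_self_iff,
    update_of_ne t.succ_ne_self, hσ]

theorem Expr.foldl_compile (L : Layout ι ρ) (p : ι → ℕ) (e : Expr ι ρ) (s : State ρ) {t : ℕ}
    {σ : ℕ → ℕ} (hσ : ∀ u > t, σ u = 0) (l : ℕ) :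
    (e.compile L t).foldl exec (s.toConfig L p σ l) =
      s.toConfig L p (update σ t (e.eval p s)) (l + e.size) := by
  have hnext : σ (t + 1) = 0 := hσ _ t.lt_succ_self
  induction e generalizing t σ l with
  | const k => simp [Expr.compile, exec, State.toConfig, Expr.eval, Expr.size]
  | param i => simp [Expr.compile, exec, State.toConfig, Expr.eval, Expr.size, hnext]
  | var x => simp [Expr.compile, exec, State.toConfig, Expr.eval, Expr.size, hnext]
  | add a b iha ihb | sub a b iha ihb =>
    have hσ' (k u : ℕ) (hu : u > t + 1) : update σ t k u = 0 := by
      rw [update_of_ne (by omega), hσ u (by omega)]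
    rw [Expr.compile, List.foldl_append, List.foldl_append, iha hσ _ hnext,
      ihb (hσ' _) _ (hσ' _ _ (by omega))]
    simp [exec, State.toConfig, Expr.eval, Expr.size, update_pair_restore hnext, add_assoc]
  | load a ih =>
    rw [Expr.compile, List.foldl_append, ih hσ _ hnext]
    simp [exec, State.toConfig, Expr.eval, Expr.size, add_assoc]

namespace Cmd

/-- The number of instructions of the code of a command. -/
def size : Cmd ι ρ → ℕ
  | .assign _ e => e.size + 2
  | .store a e => a.size + e.size + 3
  | .write e => e.size + 2
  | .emit => 1
  | .seq c d => c.size + d.size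
  | .loop _ _ c => c.size + 10

/-- Code for a command, to be placed at address `l`. It relies on the temporaries from `t` on being
zero and restores them; a loop counts its iterations in the temporary `t`. -/
def compile (L : Layout ι ρ) : Cmd ι ρ → ℕ → ℕ → Program
  | .assign x e, t, _ => e.compile L t ++
      [.add (L.var x) (L.temp t) (L.temp (t + 1)), .const (L.temp t) 0]
  | .store a e, t, _ => a.compile L t ++ e.compile L (t + 1) ++
      [.store (L.temp t) (L.temp (t + 1)), .const (L.temp t) 0, .const (L.temp (t + 1)) 0]
  | .write e, t, _ => e.compile L t ++ [.write (L.temp t), .const (L.temp t) 0]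
  | .emit, _, _ => [.emit]
  | .seq c d, t, l => c.compile L t l ++ d.compile L t (l + c.size)
  | .loop x i c, t, l =>
      [.const (L.temp t) 0,
        .sub (L.temp (t + 1)) (L.param i) (L.temp t),
        .jumpZero (L.temp (t + 1)) (l + 9 + c.size),
        .const (L.temp (t + 1)) 0,
        .add (L.var x) (L.temp t) (L.temp (t + 1))] ++
      c.compile L (t + 1) (l + 5) ++
      [.const (L.temp (t + 1)) 1,
        .add (L.temp t) (L.temp t) (L.temp (t + 1)),
        .const (L.temp (t + 1)) 0,
        .jumpZero (L.temp (t + 1)) (l + 1),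
        .const (L.temp t) 0]

@[simp]
theorem length_compile (L : Layout ι ρ) (c : Cmd ι ρ) (t l : ℕ) :
    (c.compile L t l).length = c.size := by
  induction c generalizing t l with
  | _ => simp +arith [compile, size, *]

/-- The number of steps that the code of a command takes, for the parameter values `p`. -/
def cost (p : ι → ℕ) : Cmd ι ρ → ℕ
  | .assign _ e => e.size + 2
  | .store a e => a.size + e.size + 3
  | .write e => e.size + 2
  | .emit => 1
  | .seq c d => c.cost p + d.cost p
  | .loop _ i c => 1 + p i * (c.cost p + 8) + 3

/-- A polynomial that bounds the cost in terms of a bound for the parameters. -/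
noncomputable def costPoly : Cmd ι ρ → Polynomial ℕ
  | .assign _ e => .C (e.size + 2)
  | .store a e => .C (a.size + e.size + 3)
  | .write e => .C (e.size + 2)
  | .emit => 1
  | .seq c d => c.costPoly + d.costPoly
  | .loop _ _ c => 1 + .X * (c.costPoly + .C 8) + .C 3

theorem cost_le_eval_costPoly {p : ι → ℕ} {N : ℕ} (hp : ∀ i, p i ≤ N) (c : Cmd ι ρ) :
    c.cost p ≤ c.costPoly.eval N := by
  induction c with
  | assign x e => simp [cost, costPoly]
  | store a e => simp [cost, costPoly]
  | write e => simp [cost, costPoly]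
  | emit => simp [cost, costPoly]
  | seq c d ihc ihd =>
    rw [cost, costPoly, Polynomial.eval_add]
    exact add_le_add ihc ihd
  | loop x i c ih =>
    simp only [cost, costPoly, Polynomial.eval_add, Polynomial.eval_mul, Polynomial.eval_one,
      Polynomial.eval_X, Polynomial.eval_C]
    gcongr
    exact hp i

section Correctness

variable {L : Layout ι ρ} {p : ι → ℕ} {P : Program} {σ : ℕ → ℕ} {t l : ℕ}

theorem run_straight {Q : Program} {k : ℕ} {s : State ρ} {c : Config} (hP : CodeAt P l Q)
    (hk : Q.length = k) (hQ : ∀ i ∈ Q, IsStraight i)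
    (hc : Q.foldl exec (s.toConfig L p σ l) = c) : run P (s.toConfig L p σ l) k = c := by
  rw [← hk, ← hc]
  exact run_eq_foldl_exec hP hQ

theorem run_jumpZero_of_eq_zero {s : State ρ} {a k : ℕ} (hP : P[l]? = some (.jumpZero a k))
    (ha : L.regs p s.var σ a = 0) : run P (s.toConfig L p σ l) 1 = s.toConfig L p σ k := by
  rw [run_one, step_of_getElem? hP, exec, State.toConfig, if_pos ha, State.toConfig]

theorem run_jumpZero_of_ne_zero {s : State ρ} {a k : ℕ} (hP : P[l]? = some (.jumpZero a k))
    (ha : L.regs p s.var σ a ≠ 0) : run P (s.toConfig L p σ l) 1 = s.toConfig L p σ (l + 1) := by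
  rw [run_one, step_of_getElem? hP, exec, State.toConfig, if_neg ha, State.toConfig]

theorem run_loop_init {x : ρ} {i : ι} {c : Cmd ι ρ}
    (hP : CodeAt P l ((loop x i c).compile L t l)) (s : State ρ) :
    run P (s.toConfig L p σ l) 1 = s.toConfig L p (update σ t 0) (l + 1) :=
  run_straight (CodeAt.left (Q := [_]) hP) rfl (by simp [IsStraight])
    (by simp [exec, State.toConfig])

theorem run_loop_test {x : ρ} {i : ι} {c : Cmd ι ρ}
    (hP : CodeAt P l ((loop x i c).compile L t l)) (s : State ρ) (j : ℕ) :
    run P (s.toConfig L p (update σ t j) (l + 1)) 1 =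
      s.toConfig L p (update (update σ t j) (t + 1) (p i - j)) (l + 2) :=
  run_straight (CodeAt.left (Q := [_]) hP.left.left.tail) rfl (by simp [IsStraight])
    (by simp [exec, State.toConfig])

theorem run_loop_next {x : ρ} {i : ι} {c : Cmd ι ρ}
    (hP : CodeAt P l ((loop x i c).compile L t l)) (hσ : ∀ u ≥ t, σ u = 0) (s : State ρ) (j : ℕ) :
    run P (s.toConfig L p (update σ t j) (l + 5 + c.size)) 4 =
      s.toConfig L p (update σ t (j + 1)) (l + 1) := by
  have hcount := hP.right
  rw [List.length_append, length_compile, ← add_assoc] at hcount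
  calc run P (s.toConfig L p (update σ t j) (l + 5 + c.size)) 4
      = run P (run P (s.toConfig L p (update σ t j) (l + 5 + c.size)) 3) 1 := run_add P _ 3 1
    _ = run P (s.toConfig L p (update σ t (j + 1)) (l + 5 + c.size + 3)) 1 := by
        congr 1
        refine run_straight (CodeAt.left (Q := [_, _, _]) hcount) rfl (by simp [IsStraight]) ?_
        simp [exec, State.toConfig, add_assoc, update_pair_restore (hσ _ t.le_succ)]
    _ = s.toConfig L p (update σ t (j + 1)) (l + 1) :=
        run_jumpZero_of_eq_zero hcount.tail.tail.tail.head (by simp [hσ])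

theorem run_loop_exit {x : ρ} {i : ι} {c : Cmd ι ρ}
    (hP : CodeAt P l ((loop x i c).compile L t l)) (hσ : ∀ u ≥ t, σ u = 0) (s : State ρ) :
    run P (s.toConfig L p (update σ t (p i)) (l + 1)) 3 =
      s.toConfig L p σ (l + (loop x i c).size) := by
  have hreset := hP.right
  rw [List.length_append, length_compile, ← add_assoc] at hreset
  have hzero : update σ t 0 = σ := by rw [update_eq_self_iff, hσ t le_rfl]
  have hnext : update (update σ t (p i)) (t + 1) 0 = update σ t (p i) := by
    rw [update_eq_self_iff, update_of_ne t.succ_ne_self, hσ _ t.le_succ]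
  calc run P (s.toConfig L p (update σ t (p i)) (l + 1)) 3
      = run P (run P (run P (s.toConfig L p (update σ t (p i)) (l + 1)) 1) 1) 1 := rfl
    _ = run P (run P (s.toConfig L p (update σ t (p i)) (l + 2)) 1) 1 := by
        rw [run_loop_test hP, Nat.sub_self, hnext]
    _ = run P (s.toConfig L p (update σ t (p i)) (l + 9 + c.size)) 1 := by
        rw [run_jumpZero_of_eq_zero hP.left.left.tail.tail.head (by simp [hσ])]
    _ = s.toConfig L p σ (l + (loop x i c).size) := by
        rw [show l + 9 + c.size = l + 5 + c.size + 4 by ring]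
        refine run_straight hreset.tail.tail.tail.tail rfl (by simp [IsStraight]) ?_
        simp +arith [exec, State.toConfig, size, update_idem, hzero]

variable [DecidableEq ρ]

theorem run_loop_enter {x : ρ} {i : ι} {c : Cmd ι ρ}
    (hP : CodeAt P l ((loop x i c).compile L t l)) (hσ : ∀ u ≥ t, σ u = 0) (s : State ρ) {j : ℕ}
    (hj : j < p i) :
    run P (s.toConfig L p (update σ t j) (l + 1)) 4 =
      State.toConfig { s with var := update s.var x j } L p (update σ t j) (l + 5) := by
  have hnext : update (update σ t j) (t + 1) 0 = update σ t j := by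
    rw [update_eq_self_iff, update_of_ne t.succ_ne_self, hσ _ t.le_succ]
  calc run P (s.toConfig L p (update σ t j) (l + 1)) 4
      = run P (run P (run P (s.toConfig L p (update σ t j) (l + 1)) 1) 1) 2 := rfl
    _ = run P (run P (s.toConfig L p (update (update σ t j) (t + 1) (p i - j)) (l + 2)) 1) 2 := by
        rw [run_loop_test hP]
    _ = run P (s.toConfig L p (update (update σ t j) (t + 1) (p i - j)) (l + 3)) 2 := by
        rw [run_jumpZero_of_ne_zero hP.left.left.tail.tail.head]
        simp [Nat.sub_ne_zero_of_lt hj]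
    _ = State.toConfig { s with var := update s.var x j } L p (update σ t j) (l + 5) := by
        refine run_straight hP.left.left.tail.tail.tail rfl (by simp [IsStraight]) ?_
        simp [exec, State.toConfig, update_idem, hnext, hσ]

theorem run_compile_assign {x : ρ} {e : Expr ι ρ} (hP : CodeAt P l ((assign x e).compile L t l))
    (hσ : ∀ u ≥ t, σ u = 0) (s : State ρ) :
    run P (s.toConfig L p σ l) (assign x e).size =
      ((assign x e).den p s).toConfig L p σ (l + (assign x e).size) := by
  have hzero : update σ t 0 = σ := by rw [update_eq_self_iff, hσ t le_rfl]
  refine run_straight hP (length_compile L _ t l) ?_ ?_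
  · simpa [compile, or_imp, forall_and, IsStraight] using e.isStraight_compile L t
  · rw [compile, List.foldl_append, Expr.foldl_compile L p e s fun u hu => hσ u hu.le]
    simp [exec, State.toConfig, den, size, hσ, hzero, add_assoc, update_idem]

theorem run_compile_store {a e : Expr ι ρ} (hP : CodeAt P l ((store a e).compile L t l))
    (hσ : ∀ u ≥ t, σ u = 0) (s : State ρ) :
    run P (s.toConfig L p σ l) (store a e).size =
      ((store a e).den p s).toConfig L p σ (l + (store a e).size) := by
  have hzero : update σ t 0 = σ := by rw [update_eq_self_iff, hσ t le_rfl]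
  have hσ' (k u : ℕ) (hu : u > t + 1) : update σ t k u = 0 := by
    rw [update_of_ne (by omega), hσ u (by omega)]
  refine run_straight hP (length_compile L _ t l) ?_ ?_
  · simpa [compile, or_imp, forall_and, IsStraight] using
      ⟨a.isStraight_compile L t, e.isStraight_compile L (t + 1)⟩
  · rw [compile, List.foldl_append, List.foldl_append,
      Expr.foldl_compile L p a s fun u hu => hσ u hu.le, Expr.foldl_compile L p e s (hσ' _)]
    simp [exec, State.toConfig, den, size, hσ, hzero, add_assoc, update_pair_restore]

theorem run_compile_write {e : Expr ι ρ} (hP : CodeAt P l ((write e).compile L t l))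
    (hσ : ∀ u ≥ t, σ u = 0) (s : State ρ) :
    run P (s.toConfig L p σ l) (write e).size =
      ((write e).den p s).toConfig L p σ (l + (write e).size) := by
  have hzero : update σ t 0 = σ := by rw [update_eq_self_iff, hσ t le_rfl]
  refine run_straight hP (length_compile L _ t l) ?_ ?_
  · simpa [compile, or_imp, forall_and, IsStraight] using e.isStraight_compile L t
  · rw [compile, List.foldl_append, Expr.foldl_compile L p e s fun u hu => hσ u hu.le]
    simp [exec, State.toConfig, den, size, hzero, add_assoc, update_idem]

theorem run_compile_loop {x : ρ} {i : ι} {c : Cmd ι ρ}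
    (hP : CodeAt P l ((loop x i c).compile L t l)) (hσ : ∀ u ≥ t, σ u = 0)
    (hc : ∀ (s : State ρ) (j : ℕ), run P (s.toConfig L p (update σ t j) (l + 5)) (c.cost p) =
      (c.den p s).toConfig L p (update σ t j) (l + 5 + c.size)) (s : State ρ) :
    run P (s.toConfig L p σ l) ((loop x i c).cost p) =
      ((loop x i c).den p s).toConfig L p σ (l + (loop x i c).size) := by
  have hiter (k : ℕ) (hk : k ≤ p i) :
      run P (s.toConfig L p (update σ t 0) (l + 1)) (k * (c.cost p + 8)) =
        ((List.range k).foldl (fun s j => c.den p { s with var := update s.var x j }) s).toConfig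
          L p (update σ t k) (l + 1) := by
    induction k with
    | zero => rw [Nat.zero_mul]; rfl
    | succ k ih =>
      have hcost : (k + 1) * (c.cost p + 8) = k * (c.cost p + 8) + (4 + c.cost p + 4) := by ring
      rw [hcost, run_add, ih (by omega), run_add, run_add, run_loop_enter hP hσ _ hk, hc,
        run_loop_next hP hσ, List.range_succ, List.foldl_append]
      rfl
  rw [cost, run_add, run_add, run_loop_init hP, hiter _ le_rfl, run_loop_exit hP hσ]
  rfl

theorem run_compile {c : Cmd ι ρ} (hP : CodeAt P l (c.compile L t l)) (hσ : ∀ u ≥ t, σ u = 0)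
    (s : State ρ) :
    run P (s.toConfig L p σ l) (c.cost p) = (c.den p s).toConfig L p σ (l + c.size) := by
  induction c generalizing s t l σ with
  | assign x e => exact run_compile_assign hP hσ s
  | store a e => exact run_compile_store hP hσ s
  | write e => exact run_compile_write hP hσ s
  | emit => exact run_straight hP rfl (by simp [compile, IsStraight]) rfl
  | seq c d ihc ihd =>
    have hd := hP.right
    rw [length_compile] at hd
    rw [cost, run_add, ihc hP.left hσ, ihd hd hσ, add_assoc]
    rfl
  | loop x i c ih =>
    refine run_compile_loop hP hσ (fun s j => ih hP.left.right (fun u hu => ?_) s) s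
    rw [update_of_ne (by omega), hσ u (by omega)]

end Correctness

end Cmd

end LoopLang

namespace RomanEnum

open LoopLang LoopLang.Expr LoopLang.Cmd Function

/-- The parameters of the enumeration program: the numbers of vertices and of hyperedges. -/
inductive Param where
  | vertices
  | edges

/-- The values of the parameters on an input with `n` vertices and `m` hyperedges. -/
def Param.value (n m : ℕ) : Param → ℕ
  | .vertices => n
  | .edges => m

/-- The variables of the enumeration program. The current set `S` is kept in memory behind the
incidence matrix, as the characteristic vector at address `base`. -/
inductive Var where
  | flag
  | base
  | row
  | edge
  | vertex
  | col
  | count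
  | priv
  | bad
  | pos
  | old
  | accept

namespace Var

/-- A numbering of the variables. -/
def code : Var → ℕ
  | flag => 0
  | base => 1
  | row => 2
  | edge => 3
  | vertex => 4
  | col => 5
  | count => 6
  | priv => 7
  | bad => 8
  | pos => 9
  | old => 10
  | accept => 11

theorem code_injective : Injective code := by
  intro x y h
  cases x <;> cases y <;> first | rfl | exact absurd h (by decide)

theorem code_lt (x : Var) : x.code < 12 := by
  cases x <;> decide

instance : DecidableEq Var := fun x y => decidable_of_iff (x.code = y.code) code_injective.eq_iff

end Var

open Param Var

/-- The parameters are in registers `0` and `1`, followed by the variables and the temporaries. -/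
def layout : Layout Param Var where
  toFun := Sum.elim (Param.value 0 1) (Sum.elim (fun x => x.code + 2) fun t => t + 14)
  inj' := by
    refine Injective.sumElim ?_ (Injective.sumElim ?_ ?_ ?_) ?_
    · rintro (_ | _) (_ | _) h <;> simp_all [Param.value]
    · exact fun x y h => code_injective (Nat.add_right_cancel h)
    · exact add_left_injective 14
    · intro x t
      have := x.code_lt
      omega
    · rintro (_ | _) (x | t) <;> simp only [Param.value, Sum.elim_inl, Sum.elim_inr] <;> omega

/-- With the matrix row at address `r` and the characteristic vector of `S` at address `B`, the
number of elements of `S` in the hyperedge. -/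
def rowCount (mem : ℕ → ℕ) (B n r : ℕ) : ℕ :=
  ∑ y ∈ Finset.range n, (mem (r + y) - (1 - mem (B + y)))

/-- The number of hyperedges that contain `x` and at most one element of `S`. -/
def privCount (mem : ℕ → ℕ) (B n m x : ℕ) : ℕ :=
  ∑ i ∈ Finset.range m, (mem (i * n + x) - (rowCount mem B n (i * n) - 1))

/-- The number of elements of `S` without a private hyperedge. -/
def defect (mem : ℕ → ℕ) (B n m : ℕ) : ℕ :=
  ∑ x ∈ Finset.range n, (mem (B + x) - privCount mem B n m x)

/-- The memory and the search flag after the first `j` positions have been treated in the search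
for the next set. The flag stays `1` until a position is accepted. -/
def advanceState (mem : ℕ → ℕ) (B n m : ℕ) : ℕ → (ℕ → ℕ) × ℕ
  | 0 => (mem, 1)
  | j + 1 =>
    let s := advanceState mem B n m j
    let old := s.1 (B + j)
    let accept := s.2 - old - defect (update s.1 (B + j) 1) B n m
    (update s.1 (B + j) (old - s.2 + accept), s.2 - accept)

/-- Set `count` to the number of elements of `S` in the hyperedge at address `row`. -/
def countRow : Cmd Param Var :=
  assign count (const 0) ++
  loop col vertices
    (assign count (var count + (load (var row + var col) - (const 1 - load (var base + var col)))))

/-- Set `priv` to the number of hyperedges that contain `vertex` and at most one element of `S`. -/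
def countPrivate : Cmd Param Var :=
  assign priv (const 0) ++ assign row (const 0) ++
  loop edge edges
    (countRow ++
      assign priv (var priv + (load (var row + var vertex) - (var count - const 1))) ++
      assign row (var row + param vertices))

/-- Set `bad` to the number of elements of `S` without a private hyperedge. -/
def countBad : Cmd Param Var :=
  assign bad (const 0) ++
  loop vertex vertices
    (countPrivate ++ assign bad (var bad + (load (var base + var vertex) - var priv)))

/-- Replace `S` by its successor and set `flag` to `0`, or to `1` if there is no successor. -/
def advance : Cmd Param Var :=
  assign flag (const 1) ++
  loop pos vertices
    (assign old (load (var base + var pos)) ++ store (var base + var pos) (const 1) ++ countBad ++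
      assign accept (var flag - var old - var bad) ++
      store (var base + var pos) (var old - var flag + var accept) ++
      assign flag (var flag - var accept))

/-- Compute the address of `S`. -/
def locate : Cmd Param Var :=
  assign base (const 0) ++ loop edge edges (assign base (var base + param vertices))

/-- Write the characteristic vector of the hyperedges that do not meet `S`. -/
def writeUnhit : Cmd Param Var :=
  assign row (const 0) ++
  loop edge edges (countRow ++ write (const 1 - var count) ++ assign row (var row + param vertices))

/-- Write the characteristic vector of `S`. -/
def writeSet : Cmd Param Var :=
  loop col vertices (write (load (var base + var col)))

/-- Set all variables but `flag` to `0`. -/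
def clear : Cmd Param Var :=
  assign base (const 0) ++ assign row (const 0) ++ assign edge (const 0) ++
  assign vertex (const 0) ++ assign col (const 0) ++ assign count (const 0) ++
  assign priv (const 0) ++ assign bad (const 0) ++ assign pos (const 0) ++ assign old (const 0) ++
  assign accept (const 0)

/-- Output the Roman hitting set given by `S` and replace `S` by its successor. -/
def body : Cmd Param Var :=
  locate ++ writeUnhit ++ writeSet ++ emit ++ advance ++ clear

/-- Repeat `body` until there is no successor. -/
def program : RAM.Program :=
  body.compile layout 0 0 ++ [.jumpZero (layout.var flag) 0]

variable {p : Param → ℕ}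

theorem count_den_countRow (s : State Var) :
    (countRow.den p s).var count = rowCount s.mem (s.var base) (p vertices) (s.var row) := by
  refine (den_loop_induction_of_frame (fun j e => e.var count =
    rowCount s.mem (s.var base) j (s.var row) ∧ e.mem = s.mem) ?_ ?_).1
  · simp [den, Expr.eval, rowCount]
  · rintro j e hframe ⟨hcount, hmem⟩
    have hrow := hframe row (by decide) (by decide)
    have hbase := hframe base (by decide) (by decide)
    simp [den, Expr.eval, rowCount, Finset.sum_range_succ, hrow, hbase, hcount, hmem]

theorem priv_den_countPrivate (s : State Var) :
    (countPrivate.den p s).var priv =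
      privCount s.mem (s.var base) (p vertices) (p edges) (s.var vertex) := by
  refine (den_loop_induction_of_frame (fun j e => e.var priv =
    privCount s.mem (s.var base) (p vertices) j (s.var vertex) ∧
      e.var row = j * p vertices ∧ e.mem = s.mem) ?_ ?_).1
  · simp [den, Expr.eval, privCount]
  · rintro j e hframe ⟨hpriv, hrow, hmem⟩
    have hvertex := hframe vertex (by decide) (by decide)
    have hbase := hframe base (by decide) (by decide)
    simp (disch := decide) [den, Expr.eval, privCount, Finset.sum_range_succ, add_one_mul,
      var_den, mem_den, count_den_countRow, hpriv, hrow, hmem, hvertex, hbase]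

theorem bad_den_countBad (s : State Var) :
    (countBad.den p s).var bad = defect s.mem (s.var base) (p vertices) (p edges) := by
  refine (den_loop_induction_of_frame (fun j e => e.var bad =
    ∑ x ∈ Finset.range j, (s.mem (s.var base + x) -
      privCount s.mem (s.var base) (p vertices) (p edges) x) ∧ e.mem = s.mem) ?_ ?_).1
  · simp [den, Expr.eval]
  · rintro j e hframe ⟨hbad, hmem⟩
    have hbase := hframe base (by decide) (by decide)
    simp (disch := decide) [den, Expr.eval, Finset.sum_range_succ, var_den, mem_den,
      priv_den_countPrivate, hbad, hmem, hbase]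

theorem den_advance (s : State Var) :
    ((advance.den p s).mem, (advance.den p s).var flag) =
        advanceState s.mem (s.var base) (p vertices) (p edges) (p vertices) ∧
      (advance.den p s).word = s.word ∧ (advance.den p s).out = s.out := by
  refine den_loop_induction_of_frame (fun j e => (e.mem, e.var flag) =
    advanceState s.mem (s.var base) (p vertices) (p edges) j ∧
      e.word = s.word ∧ e.out = s.out) ?_ ?_
  · simp [den, Expr.eval, advanceState]
  · rintro j e hframe ⟨hstate, hword, hout⟩
    have hbase := hframe base (by decide) (by decide)
    simp (disch := decide) [den, Expr.eval, advanceState, var_den, mem_den, word_den, out_den,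
      bad_den_countBad, ← hstate, hword, hout, hbase]

theorem base_den_locate (s : State Var) :
    (locate.den p s).var base = p edges * p vertices := by
  refine den_loop_induction (fun j e => e.var base = j * p vertices) ?_ ?_
  · simp [den, Expr.eval]
  · rintro j e hbase
    simp [den, Expr.eval, add_one_mul, hbase]

theorem den_writeUnhit (s : State Var) :
    (writeUnhit.den p s).word = s.word ++ (List.range (p edges)).map (fun i =>
        1 - rowCount s.mem (s.var base) (p vertices) (i * p vertices)) ∧
      (writeUnhit.den p s).mem = s.mem ∧ (writeUnhit.den p s).out = s.out := by
  have h : _ ∧ (writeUnhit.den p s).var row = p edges * p vertices :=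
    den_loop_induction_of_frame (fun j e => (e.word = s.word ++ (List.range j).map (fun i =>
      1 - rowCount s.mem (s.var base) (p vertices) (i * p vertices)) ∧
        e.mem = s.mem ∧ e.out = s.out) ∧ e.var row = j * p vertices) ?_ ?_
  · exact h.1
  · simp [den, Expr.eval]
  · rintro j e hframe ⟨⟨hword, hmem, hout⟩, hrow⟩
    have hbase := hframe base (by decide) (by decide)
    simp (disch := decide) [den, Expr.eval, List.range_succ, add_one_mul, var_den, mem_den,
      word_den, out_den, count_den_countRow, hword, hmem, hout, hrow, hbase]

theorem den_writeSet (s : State Var) :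
    (writeSet.den p s).word =
        s.word ++ (List.range (p vertices)).map (fun x => s.mem (s.var base + x)) ∧
      (writeSet.den p s).mem = s.mem ∧ (writeSet.den p s).out = s.out := by
  refine den_loop_induction_of_frame (fun j e => e.word =
    s.word ++ (List.range j).map (fun x => s.mem (s.var base + x)) ∧
      e.mem = s.mem ∧ e.out = s.out) ?_ ?_
  · simp
  · rintro j e hframe ⟨hword, hmem, hout⟩
    have hbase := hframe base (by decide) (by decide)
    simp [den, Expr.eval, List.range_succ, hword, hmem, hout, hbase]

theorem den_clear (s : State Var) :
    clear.den p s = { s with var := update (0 : Var → ℕ) flag (s.var flag) } := by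
  have hvar : (clear.den p s).var = update (0 : Var → ℕ) flag (s.var flag) := by
    funext x
    cases x <;> rfl
  rw [← hvar]
  rfl

/-- The word that is output for the memory `mem`. -/
def outputWord (mem : ℕ → ℕ) (n m : ℕ) : List ℕ :=
  (List.range m).map (fun i => 1 - rowCount mem (m * n) n (i * n)) ++
    (List.range n).map fun x => mem (m * n + x)

theorem den_body (n m : ℕ) (mem : ℕ → ℕ) (out : List (List ℕ)) :
    body.den (Param.value n m) ⟨0, mem, [], out⟩ =
      ⟨update (0 : Var → ℕ) flag (advanceState mem (m * n) n m n).2,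
        (advanceState mem (m * n) n m n).1, [], out ++ [outputWord mem n m]⟩ := by
  let p := Param.value n m
  let s₁ := locate.den p ⟨0, mem, [], out⟩
  let s₂ := writeUnhit.den p s₁
  let s₃ := writeSet.den p s₂
  let s₄ := advance.den p (emit.den p s₃)
  have hbase₁ : s₁.var base = m * n := base_den_locate _
  have hmem₁ : s₁.mem = mem := mem_den (by decide) _
  have hword₁ : s₁.word = [] := word_den (by decide) _
  have hout₁ : s₁.out = out := out_den (by decide) _
  obtain ⟨hword₂, hmem₂, hout₂⟩ := den_writeUnhit (p := p) s₁
  have hbase₂ : s₂.var base = m * n := (var_den (by decide) _).trans hbase₁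
  obtain ⟨hword₃, hmem₃, hout₃⟩ := den_writeSet (p := p) s₂
  have hbase₃ : s₃.var base = m * n := (var_den (by decide) _).trans hbase₂
  obtain ⟨hstate₄, hword₄, hout₄⟩ := den_advance (p := p) (emit.den p s₃)
  have hword : s₃.word = outputWord mem n m := by
    rw [hword₃, hbase₂, hmem₂, hword₂, hword₁, hbase₁, hmem₁]
    rfl
  have hmem : s₃.mem = mem := by rw [hmem₃, hmem₂, hmem₁]
  have hout : s₃.out = out := by rw [hout₃, hout₂, hout₁]
  have hstate : (s₄.mem, s₄.var flag) = advanceState mem (m * n) n m n := by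
    rw [hstate₄, ← hbase₃, ← hmem]
    rfl
  calc body.den p ⟨0, mem, [], out⟩
    _ = clear.den p s₄ := rfl
    _ = ⟨update (0 : Var → ℕ) flag (s₄.var flag), s₄.mem, s₄.word, s₄.out⟩ := den_clear s₄
    _ = _ := by
      rw [hword₄, hout₄, ← hstate, ← hword, ← hout]
      rfl

end RomanEnum

namespace RomanEnum

open RAM IndexedHypergraph Function

variable {n m : ℕ} {H : IndexedHypergraph (Fin n) (Fin m)} {S : Finset (Fin n)}

open Classical in
/-- The memory that holds the incidence matrix of `H` and the characteristic vector of `S`. -/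
noncomputable def memory (H : IndexedHypergraph (Fin n) (Fin m)) (S : Finset (Fin n)) : ℕ → ℕ :=
  fun a => if ∃ (i : Fin m) (x : Fin n), a = i * n + x ∧ x ∈ H.edge i then 1
    else if ∃ x : Fin n, a = m * n + x ∧ x ∈ S then 1 else 0

theorem memory_empty (H : IndexedHypergraph (Fin n) (Fin m)) : memory H ∅ = (start H).mem := by
  funext a
  simp [memory, start]

theorem matrix_address_lt (i : Fin m) (x : Fin n) : (i : ℕ) * n + x < m * n :=
  calc (i : ℕ) * n + x < i * n + n := Nat.add_lt_add_left x.isLt _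
    _ = (i + 1) * n := (Nat.succ_mul _ _).symm
    _ ≤ m * n := Nat.mul_le_mul_right n i.isLt

theorem matrix_address_injective {i j : Fin m} {x y : Fin n}
    (h : (i : ℕ) * n + x = j * n + y) : i = j ∧ x = y := by
  rw [mul_comm, mul_comm (j : ℕ)] at h
  have hn : 0 < n := x.pos
  have hdiv := congrArg (· / n) h
  have hmod := congrArg (· % n) h
  simp only [Nat.mul_add_div hn, Nat.mul_add_mod, Nat.div_eq_of_lt, Nat.mod_eq_of_lt, Fin.isLt,
    add_zero] at hdiv hmod
  exact ⟨Fin.ext hdiv, Fin.ext hmod⟩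

theorem memory_matrix (H : IndexedHypergraph (Fin n) (Fin m)) (S : Finset (Fin n)) (i : Fin m)
    (x : Fin n) : memory H S (i * n + x) = if x ∈ H.edge i then 1 else 0 := by
  have hmatrix : (∃ (j : Fin m) (y : Fin n), (i : ℕ) * n + x = j * n + y ∧ y ∈ H.edge j) ↔
      x ∈ H.edge i := by
    refine ⟨?_, fun h => ⟨i, x, rfl, h⟩⟩
    rintro ⟨j, y, h, hy⟩
    obtain ⟨rfl, rfl⟩ := matrix_address_injective h
    exact hy
  have hset : ¬ ∃ y : Fin n, (i : ℕ) * n + x = m * n + y ∧ y ∈ S := by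
    rintro ⟨y, hy, -⟩
    have := matrix_address_lt i x
    omega
  simp only [memory, hmatrix, hset, if_false]

theorem memory_of_le {a : ℕ} (ha : m * n ≤ a) [Decidable (∃ x : Fin n, a = m * n + x ∧ x ∈ S)] :
    memory H S a = if ∃ x : Fin n, a = m * n + x ∧ x ∈ S then 1 else 0 := by
  have hmatrix : ¬ ∃ (i : Fin m) (x : Fin n), a = i * n + x ∧ x ∈ H.edge i := by
    rintro ⟨i, x, rfl, -⟩
    exact (matrix_address_lt i x).not_ge ha
  rw [memory, if_neg hmatrix]
  congr

theorem memory_set (H : IndexedHypergraph (Fin n) (Fin m)) (S : Finset (Fin n)) (x : Fin n) :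
    memory H S (m * n + x) = if x ∈ S then 1 else 0 := by
  simp [memory_of_le, Fin.val_inj]

theorem memory_eq_zero {a : ℕ} (ha : m * n + n ≤ a) : memory H S a = 0 := by
  have hset : ¬ ∃ x : Fin n, a = m * n + x ∧ x ∈ S := by
    rintro ⟨x, rfl, -⟩
    exact x.isLt.not_ge (Nat.add_le_add_iff_left.1 ha)
  rw [memory_of_le ((Nat.le_add_right _ _).trans ha), if_neg hset]

theorem memory_le_one (H : IndexedHypergraph (Fin n) (Fin m)) (S : Finset (Fin n)) (a : ℕ) :
    memory H S a ≤ 1 := by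
  unfold memory
  split_ifs <;> decide

theorem update_memory {T : Finset (Fin n)} {x : Fin n} {b : ℕ} (hx : b = if x ∈ T then 1 else 0)
    (h : ∀ y, y ≠ x → (y ∈ S ↔ y ∈ T)) :
    update (memory H S) (m * n + x) b = memory H T := by
  funext a
  rw [update_apply]
  split_ifs with ha
  · rw [ha, memory_set, hx]
  · have hset : (∃ y : Fin n, a = m * n + y ∧ y ∈ S) ↔ ∃ y : Fin n, a = m * n + y ∧ y ∈ T := by
      refine exists_congr fun y => and_congr_right fun hy => h y ?_
      rintro rfl
      exact ha hy
    simp only [memory, hset]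

theorem rowCount_memory (H : IndexedHypergraph (Fin n) (Fin m)) (S : Finset (Fin n)) (i : Fin m) :
    rowCount (memory H S) (m * n) n (i * n) = (H.edge i ∩ S).card := by
  have hterm : ∀ x : Fin n, (if x ∈ H.edge i then 1 else 0) - (1 - if x ∈ S then 1 else 0) =
      if x ∈ H.edge i ∩ S then 1 else 0 := by
    intro x
    by_cases hi : x ∈ H.edge i <;> by_cases hS : x ∈ S <;> simp [hi, hS]
  simp only [rowCount, Finset.sum_range, memory_matrix, memory_set, hterm, Finset.sum_boole,
    Finset.filter_univ_mem, Nat.cast_id]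

theorem privCount_memory_pos_iff {x : Fin n} (hx : x ∈ S) :
    0 < privCount (memory H S) (m * n) n m x ↔ ∃ i, H.edge i ∩ S = {x} := by
  simp only [privCount, Finset.sum_range, rowCount_memory, memory_matrix, Finset.sum_pos_iff,
    Finset.mem_univ, true_and, inter_eq_singleton_iff hx]
  refine exists_congr fun i => ?_
  by_cases hi : x ∈ H.edge i
  · simp only [hi, if_true, true_and]
    omega
  · simp [hi]

theorem defect_memory_eq_zero_iff :
    defect (memory H S) (m * n) n m = 0 ↔ H.IsIrredundant Finset.univ S := by
  simp only [defect, Finset.sum_range, Finset.sum_eq_zero_iff, Finset.mem_univ, true_imp_iff,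
    memory_set, IsIrredundant, true_and]
  refine forall_congr' fun x => ?_
  by_cases hx : x ∈ S
  · simp only [hx, if_true, true_imp_iff, ← privCount_memory_pos_iff hx, Nat.sub_eq_zero_iff_le]
    rfl
  · simp [hx]

theorem update_memory_one (v : Fin n) :
    update (memory H {x ∈ S | v.val ≤ x.val}) (m * n + v) 1 = memory H (candidate S v) := by
  refine update_memory (by simp [candidate]) fun y hy => ?_
  simp only [candidate, Finset.mem_filter, Finset.mem_insert, hy, false_or]
  exact and_congr_right fun _ => (Ne.symm hy).le_iff_lt

theorem update_memory_zero (v : Fin n) :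
    update (memory H {x ∈ S | v.val ≤ x.val}) (m * n + v) 0 =
      memory H {x ∈ S | v.val + 1 ≤ x.val} := by
  refine update_memory (by simp) fun y hy => ?_
  simp only [Finset.mem_filter]
  exact and_congr_right fun _ => (Ne.symm hy).le_iff_lt

theorem advanceState_succ_of_isPivot {v : Fin n} (hv : H.IsPivot Finset.univ S v)
    (hs : advanceState (memory H S) (m * n) n m v = (memory H {x ∈ S | v.val ≤ x.val}, 1)) :
    advanceState (memory H S) (m * n) n m (v + 1) = (memory H (candidate S v), 0) := by
  simp only [advanceState, hs, update_memory_one, defect_memory_eq_zero_iff.2 hv.2, memory_set,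
    Finset.mem_filter, hv.1, false_and, if_false]
  exact Prod.ext (update_memory_one v) rfl

theorem advanceState_succ_of_not_isPivot {v : Fin n} (hv : ¬ H.IsPivot Finset.univ S v)
    (hs : advanceState (memory H S) (m * n) n m v = (memory H {x ∈ S | v.val ≤ x.val}, 1)) :
    advanceState (memory H S) (m * n) n m (v + 1) = (memory H {x ∈ S | v.val + 1 ≤ x.val}, 1) := by
  have hold : memory H {x ∈ S | v.val ≤ x.val} (m * n + v) = if v ∈ S then 1 else 0 := by
    simp [memory_set]
  have haccept : 1 - (if v ∈ S then 1 else 0) -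
      defect (memory H (candidate S v)) (m * n) n m = 0 := by
    by_cases hvS : v ∈ S
    · simp [hvS]
    · have := mt defect_memory_eq_zero_iff.1 fun h => hv ⟨hvS, h⟩
      omega
  have hnew : (if v ∈ S then 1 else 0) - 1 + 0 = 0 := by
    split_ifs <;> rfl
  simp only [advanceState, hs, update_memory_one, hold, haccept, hnew, update_memory_zero]

theorem advanceState_eq_of_forall_not_isPivot {j : ℕ} (hj : j ≤ n)
    (h : ∀ v : Fin n, v.val < j → ¬ H.IsPivot Finset.univ S v) :
    advanceState (memory H S) (m * n) n m j = (memory H {x ∈ S | j ≤ x.val}, 1) := by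
  induction j with
  | zero => simp [advanceState]
  | succ j ih =>
    exact advanceState_succ_of_not_isPivot (v := ⟨j, hj⟩) (h _ j.lt_succ_self)
      (ih (Nat.le_of_succ_le hj) fun v hv => h v (hv.trans j.lt_succ_self))

theorem advanceState_eq_of_snd_eq_zero {mem mem' : ℕ → ℕ} {B i j : ℕ}
    (h : advanceState mem B n m i = (mem', 0)) (hij : i ≤ j) :
    advanceState mem B n m j = (mem', 0) := by
  induction j, hij using Nat.le_induction with
  | base => exact h
  | succ j _ ih => simp [advanceState, ih]

theorem advanceState_eq_of_isPivot {v : Fin n} (hv : H.IsPivot Finset.univ S v)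
    (hmin : ∀ u < v, ¬ H.IsPivot Finset.univ S u) :
    advanceState (memory H S) (m * n) n m n = (memory H (candidate S v), 0) :=
  advanceState_eq_of_snd_eq_zero (advanceState_succ_of_isPivot hv
    (advanceState_eq_of_forall_not_isPivot v.isLt.le hmin)) v.isLt

theorem advanceState_of_isLeast {T : Colex (Finset (Fin n))}
    (hT : IsLeast {T | H.IsIrredundant Finset.univ (ofColex T) ∧ toColex S < T} T) :
    advanceState (memory H S) (m * n) n m n = (memory H (ofColex T), 0) := by
  obtain ⟨w, hw, -⟩ := exists_isPivot_of_toColex_lt hT.1.1 hT.1.2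
  obtain ⟨v, hv, hmin⟩ := exists_minimal_of_wellFoundedLT (H.IsPivot Finset.univ S) ⟨w, hw⟩
  have hmin : ∀ u < v, ¬ H.IsPivot Finset.univ S u := fun u hu hpivot =>
    hu.not_ge (hmin hpivot hu.le)
  rw [hT.unique (hv.isLeast_toColex_candidate hmin), ofColex_toColex]
  exact advanceState_eq_of_isPivot hv hmin

theorem snd_advanceState_of_forall_le
    (hmax : ∀ T, H.IsIrredundant Finset.univ T → toColex T ≤ toColex S) :
    (advanceState (memory H S) (m * n) n m n).2 = 1 := by
  rw [advanceState_eq_of_forall_not_isPivot le_rfl fun v _ hv =>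
    (hmax _ hv.2).not_gt (toColex_lt_candidate hv.1)]

end RomanEnum

namespace RomanEnum

open RAM IndexedHypergraph LoopLang LoopLang.Cmd Function

variable {n m : ℕ} {H : IndexedHypergraph (Fin n) (Fin m)} {S : Finset (Fin n)}
  {out : List (List ℕ)} {k t : ℕ}

theorem ofFn_ite_mem_injective (n : ℕ) :
    Injective fun S : Finset (Fin n) => List.ofFn fun x => if x ∈ S then 1 else 0 := by
  intro S T h
  ext x
  have hx := congrFun (List.ofFn_injective h) x
  by_cases hS : x ∈ S <;> by_cases hT : x ∈ T <;> simp_all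

theorem encode_injective : Injective (encode : Finset (Fin m) × Finset (Fin n) → List ℕ) := by
  intro R Q h
  obtain ⟨h₁, h₂⟩ := List.append_inj h (by simp)
  exact Prod.ext (ofFn_ite_mem_injective m h₁) (ofFn_ite_mem_injective n h₂)

theorem map_range_eq_ofFn {α : Type*} (f : ℕ → α) (n : ℕ) :
    (List.range n).map f = List.ofFn fun i : Fin n => f i :=
  List.ext_getElem (by simp) (by simp)

theorem outputWord_memory (H : IndexedHypergraph (Fin n) (Fin m)) (S : Finset (Fin n)) :
    outputWord (memory H S) n m = encode (H.unhit S, S) := by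
  have hunhit : ∀ i : Fin m, 1 - (H.edge i ∩ S).card = if i ∈ H.unhit S then 1 else 0 := by
    intro i
    simp only [mem_unhit, ← Finset.card_eq_zero]
    split_ifs <;> omega
  simp only [outputWord, encode, map_range_eq_ofFn, rowCount_memory, hunhit, memory_set]

/-- The configuration of the enumeration program when it is about to output the set `S`. -/
noncomputable def checkpoint (H : IndexedHypergraph (Fin n) (Fin m)) (S : Finset (Fin n))
    (out : List (List ℕ)) : Config :=
  State.toConfig ⟨0, memory H S, [], out⟩ layout (Param.value n m) 0 0

theorem regs_layout_zero (n m : ℕ) :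
    layout.regs (Param.value n m) 0 0 = fun r => if r = 0 then n else if r = 1 then m else 0 := by
  funext r
  by_cases hr : ∃ a, layout a = r
  · obtain ⟨a, rfl⟩ := hr
    rw [Layout.regs, layout.injective.extend_apply]
    rcases a with (_ | _) | x | t <;> rfl
  · have hne : r ≠ 0 ∧ r ≠ 1 :=
      ⟨fun h => hr ⟨.inl .vertices, h.symm⟩, fun h => hr ⟨.inl .edges, h.symm⟩⟩
    rw [Layout.regs, extend_apply' _ _ _ hr, if_neg hne.1, if_neg hne.2, Pi.zero_apply]

theorem start_eq_checkpoint (H : IndexedHypergraph (Fin n) (Fin m)) :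
    start H = checkpoint H ∅ [] := by
  rw [checkpoint, State.toConfig, regs_layout_zero, memory_empty]
  rfl

/-- The number of steps between two checkpoints. -/
def period (n m : ℕ) : ℕ := body.cost (Param.value n m) + 1

theorem period_pos (n m : ℕ) : 0 < period n m :=
  Nat.succ_pos _

theorem run_body {mem : ℕ → ℕ} {e : ℕ}
    (h : advanceState (memory H S) (m * n) n m n = (mem, e)) (out : List (List ℕ)) :
    run program (checkpoint H S out) (body.cost (Param.value n m)) =
      State.toConfig ⟨update (0 : Var → ℕ) .flag e, mem, [], out ++ [encode (H.unhit S, S)]⟩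
        layout (Param.value n m) 0 body.size := by
  have hcode : CodeAt program 0 (body.compile layout 0 0) := CodeAt.append_left _ _
  rw [checkpoint, run_compile (σ := 0) hcode (fun _ _ => rfl), den_body, h, outputWord_memory,
    zero_add]

theorem getElem?_program : program[body.size]? = some (.jumpZero (layout.var .flag) 0) := by
  rw [program, ← length_compile layout body 0 0, List.getElem?_concat_length]

theorem run_period_of_isLeast {T : Colex (Finset (Fin n))}
    (hT : IsLeast {T | H.IsIrredundant Finset.univ (ofColex T) ∧ toColex S < T} T)
    (out : List (List ℕ)) :
    run program (checkpoint H S out) (period n m) =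
      checkpoint H (ofColex T) (out ++ [encode (H.unhit S, S)]) := by
  rw [period, run_add, run_body (advanceState_of_isLeast hT),
    run_jumpZero_of_eq_zero getElem?_program (by simp)]
  simp [checkpoint]

theorem run_period_of_forall_le
    (hmax : ∀ T, H.IsIrredundant Finset.univ T → toColex T ≤ toColex S) (out : List (List ℕ)) :
    Halted program (run program (checkpoint H S out) (period n m)) ∧
      (run program (checkpoint H S out) (period n m)).out = out ++ [encode (H.unhit S, S)] := by
  have hflag : advanceState (memory H S) (m * n) n m n =
      ((advanceState (memory H S) (m * n) n m n).1, 1) :=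
    Prod.ext rfl (snd_advanceState_of_forall_le hmax)
  rw [period, run_add, run_body hflag, run_jumpZero_of_ne_zero getElem?_program (by simp)]
  refine ⟨?_, rfl⟩
  simp [Halted, State.toConfig, program, length_compile]

/-- The irredundant sets of vertices in colexicographic order. -/
noncomputable def sortedSets (H : IndexedHypergraph (Fin n) (Fin m)) :
    List (Colex (Finset (Fin n))) :=
  ((H.irredundantSets Finset.univ Finset.univ).map toColex.toEmbedding).sort

theorem mem_sortedSets {T : Colex (Finset (Fin n))} :
    T ∈ sortedSets H ↔ H.IsIrredundant Finset.univ (ofColex T) := by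
  simp [sortedSets, mem_irredundantSets]

theorem sortedLT_sortedSets (H : IndexedHypergraph (Fin n) (Fin m)) : (sortedSets H).SortedLT :=
  Finset.sortedLT_sort _

theorem length_sortedSets (H : IndexedHypergraph (Fin n) (Fin m)) :
    (sortedSets H).length = (H.irredundantSets Finset.univ Finset.univ).card := by
  simp [sortedSets]

theorem exists_getElem_sortedSets {T : Finset (Fin n)} (hT : H.IsIrredundant Finset.univ T) :
    ∃ (i : ℕ) (hi : i < (sortedSets H).length), (sortedSets H)[i] = toColex T :=
  List.getElem_of_mem (mem_sortedSets.2 hT)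

theorem length_sortedSets_pos (H : IndexedHypergraph (Fin n) (Fin m)) :
    0 < (sortedSets H).length :=
  List.length_pos_of_mem (mem_sortedSets (T := toColex ∅) |>.2 (H.isIrredundant_empty _))

theorem getElem_zero_sortedSets (H : IndexedHypergraph (Fin n) (Fin m)) :
    (sortedSets H)[0]'(length_sortedSets_pos H) = toColex ∅ := by
  obtain ⟨i, hi, h⟩ := exists_getElem_sortedSets (H.isIrredundant_empty Finset.univ)
  refine le_antisymm ?_ bot_le
  rw [← h, (sortedLT_sortedSets H).getElem_le_getElem_iff]
  exact Nat.zero_le i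

theorem isLeast_getElem_succ_sortedSets (hk : k + 1 < (sortedSets H).length) :
    IsLeast {T | H.IsIrredundant Finset.univ (ofColex T) ∧ (sortedSets H)[k] < T}
      (sortedSets H)[k + 1] := by
  have hsorted := sortedLT_sortedSets H
  refine ⟨⟨mem_sortedSets.1 (List.getElem_mem hk),
    hsorted.getElem_lt_getElem_iff.2 k.lt_succ_self⟩, ?_⟩
  rintro T ⟨hT, hlt⟩
  obtain ⟨i, hi, rfl⟩ := exists_getElem_sortedSets hT
  exact hsorted.getElem_le_getElem_iff.2 (hsorted.getElem_lt_getElem_iff.1 hlt)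

theorem toColex_le_last_sortedSets (hk : k + 1 = (sortedSets H).length) {T : Finset (Fin n)}
    (hT : H.IsIrredundant Finset.univ T) : toColex T ≤ (sortedSets H)[k] := by
  obtain ⟨i, hi, h⟩ := exists_getElem_sortedSets hT
  rw [← h]
  exact (sortedLT_sortedSets H).getElem_le_getElem_iff.2 (by omega)

/-- The words that are output for the first `k` irredundant sets. -/
noncomputable def outputs (H : IndexedHypergraph (Fin n) (Fin m)) (k : ℕ) : List (List ℕ) :=
  ((sortedSets H).take k).map fun S => encode (H.unhit (ofColex S), ofColex S)

theorem outputs_succ (hk : k < (sortedSets H).length) :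
    outputs H (k + 1) = outputs H k ++
      [encode (H.unhit (ofColex (sortedSets H)[k]), ofColex (sortedSets H)[k])] := by
  rw [outputs, outputs, List.take_succ_eq_append_getElem hk, List.map_append]
  rfl

theorem nodup_outputs_length (H : IndexedHypergraph (Fin n) (Fin m)) :
    (outputs H (sortedSets H).length).Nodup := by
  rw [outputs, List.take_length]
  exact (sortedLT_sortedSets H).nodup.map fun S T h =>
    ofColex_inj.1 (congrArg Prod.snd (encode_injective h))

theorem mem_outputs_length {w : List ℕ} :
    w ∈ outputs H (sortedSets H).length ↔
      ∃ R : Finset (Fin m) × Finset (Fin n), H.IsMinimalRomanHittingSet R ∧ w = encode R := by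
  rw [outputs, List.take_length, List.mem_map]
  constructor
  · rintro ⟨S, hS, rfl⟩
    exact ⟨_, isMinimalRomanHittingSet_iff.2 ⟨mem_sortedSets.1 hS, rfl⟩, rfl⟩
  · rintro ⟨R, hR, rfl⟩
    obtain ⟨hirr, hunhit⟩ := isMinimalRomanHittingSet_iff.1 hR
    refine ⟨toColex R.2, mem_sortedSets.2 hirr, ?_⟩
    rw [ofColex_toColex, ← hunhit]

theorem run_mul_period (hk : k < (sortedSets H).length) :
    run program (start H) (k * period n m) =
      checkpoint H (ofColex (sortedSets H)[k]) (outputs H k) := by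
  induction k with
  | zero =>
    rw [zero_mul, getElem_zero_sortedSets]
    exact start_eq_checkpoint H
  | succ k ih =>
    have hk' : k < (sortedSets H).length := Nat.lt_of_succ_lt hk
    rw [add_one_mul, run_add, ih hk', outputs_succ hk']
    exact run_period_of_isLeast (isLeast_getElem_succ_sortedSets hk) _

theorem run_length_mul_period (H : IndexedHypergraph (Fin n) (Fin m)) :
    Halted program (run program (start H) ((sortedSets H).length * period n m)) ∧
      (run program (start H) ((sortedSets H).length * period n m)).out =
        outputs H (sortedSets H).length := by
  obtain ⟨k, hk⟩ := Nat.exists_eq_add_of_lt (length_sortedSets_pos H)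
  rw [zero_add] at hk
  have hk' : k < (sortedSets H).length := hk ▸ k.lt_succ_self
  rw [hk, add_one_mul, run_add, run_mul_period hk', outputs_succ hk']
  exact run_period_of_forall_le (fun T hT => toColex_le_last_sortedSets hk.symm hT) _

theorem length_out_run_mul_period (hk : k ≤ (sortedSets H).length) :
    (run program (start H) (k * period n m)).out.length = k := by
  have hlength : (outputs H k).length = k := by simp [outputs, hk]
  rcases hk.eq_or_lt with rfl | hk
  · rw [(run_length_mul_period H).2, hlength]
  · rw [run_mul_period hk]
    exact hlength

theorem exists_enumeratesInTime (H : IndexedHypergraph (Fin n) (Fin m)) :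
    ∃ T ≤ (sortedSets H).length * period n m, EnumeratesInTime program H T := by
  obtain ⟨hhalted, hout⟩ := run_length_mul_period H
  obtain ⟨T, hT, hhalts, hrun⟩ := exists_haltsAt_of_halted hhalted
  refine ⟨T, hT, hhalts, ?_⟩
  rw [hrun, hout]
  exact ⟨nodup_outputs_length H, fun _ => mem_outputs_length⟩

theorem delayLE {T d : ℕ} (hT : T ≤ (sortedSets H).length * period n m)
    (hd : 2 * period n m ≤ d) : DelayLE program H T d := by
  intro t _
  have hperiodic := out_length_lt_of_periodic (period_pos n m)
    (fun k hk => length_out_run_mul_period (H := H) hk) t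
  refine hperiodic.imp (fun h => ?_) fun h => ?_
  · exact hT.trans (h.trans (Nat.add_le_add_left hd t))
  · exact h.trans_le (monotone_out_length program (start H) (Nat.add_le_add_left hd t))

end RomanEnum

namespace RomanEnum

open RAM IndexedHypergraph LoopLang

variable {n m : ℕ} {H : IndexedHypergraph (Fin n) (Fin m)}

/-- A polynomial in `n + m` that exceeds the number of nonzero entries at a checkpoint, as well as
their addresses and values. -/
noncomputable def inputPoly : Polynomial ℕ :=
  .X ^ 2 + .X + 2

theorem eval_inputPoly (N : ℕ) : inputPoly.eval N = N ^ 2 + N + 2 := by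
  simp [inputPoly]

theorem sizeLE_checkpoint (H : IndexedHypergraph (Fin n) (Fin m)) (S : Finset (Fin n))
    (out : List (List ℕ)) :
    (checkpoint H S out).SizeLE (inputPoly.eval (n + m)) (inputPoly.eval (n + m)) := by
  have hmul : m * n + n ≤ (n + m) ^ 2 + (n + m) := by nlinarith
  rw [eval_inputPoly]
  have hpow : (n + m) ^ 2 + (n + m) + 2 < 2 ^ ((n + m) ^ 2 + (n + m) + 2) := Nat.lt_two_pow_self
  constructor
  · refine ⟨{0, 1}, by simp, by simp, fun r hr => ?_, fun r => ?_⟩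
    · rw [Finset.mem_insert, Finset.mem_singleton, not_or] at hr
      simp [checkpoint, State.toConfig, regs_layout_zero, hr]
    · rw [checkpoint, State.toConfig, regs_layout_zero]
      dsimp only
      split_ifs <;> omega
  · refine ⟨Finset.range (m * n + n), ?_, fun a ha => ?_, fun a ha => ?_, fun a => ?_⟩
    · rw [Finset.card_range]
      omega
    · rw [Finset.mem_range] at ha
      omega
    · exact memory_eq_zero (not_lt.1 (Finset.mem_range.not.1 ha))
    · exact (memory_le_one H S a).trans_lt (by omega)

/-- A polynomial bound, in terms of `n + m`, for the period. -/
noncomputable def periodPoly : Polynomial ℕ :=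
  body.costPoly + 1

theorem period_le_eval_periodPoly (n m : ℕ) : period n m ≤ periodPoly.eval (n + m) := by
  have hparam (i : Param) : i.value n m ≤ n + m := by
    cases i
    exacts [Nat.le_add_right n m, Nat.le_add_left m n]
  rw [period, periodPoly, Polynomial.eval_add, Polynomial.eval_one]
  exact Nat.succ_le_succ (Cmd.cost_le_eval_costPoly hparam body)

theorem exists_lt_le_eq_mul_add {N d t : ℕ} (hN : 0 < N) (hd : 0 < d) (ht : t ≤ N * d) :
    ∃ k < N, ∃ j ≤ d, t = k * d + j := by
  rcases t with _ | t
  · exact ⟨0, hN, 0, d.zero_le, by simp⟩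
  · exact ⟨t / d, Nat.div_lt_of_lt_mul (by rwa [mul_comm]), t % d + 1, Nat.mod_lt t hd,
      by rw [← add_assoc, Nat.div_add_mod']⟩

/-- A polynomial bound for the bits in use; `b` bounds the numbers in the program text. -/
noncomputable def spacePoly (b : ℕ) : Polynomial ℕ :=
  2 * ((inputPoly + periodPoly) * (2 * (.C b + inputPoly + periodPoly) + 1))

/-- Since the configuration returns to a checkpoint after each period, its size grows only during
a single period. -/
theorem spaceLE_run {b t : ℕ} (hb : ∀ i ∈ program, i.literal < 2 ^ b)
    (ht : t ≤ (sortedSets H).length * period n m) :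
    SpaceLE (run program (start H) t) ((spacePoly b).eval (n + m)) := by
  obtain ⟨k, hk, j, hj, rfl⟩ :=
    exists_lt_le_eq_mul_add (length_sortedSets_pos H) (period_pos n m) ht
  have hj' : j ≤ periodPoly.eval (n + m) := hj.trans (period_le_eval_periodPoly n m)
  set N := inputPoly.eval (n + m)
  have hcheckpoint : (run program (start H) (k * period n m)).SizeLE N (b + N) := by
    rw [run_mul_period hk]
    have hsize := sizeLE_checkpoint H (ofColex (sortedSets H)[k]) (outputs H k)
    exact ⟨hsize.1.mono le_rfl (Nat.le_add_left N b), hsize.2.mono le_rfl (Nat.le_add_left N b)⟩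
  have hliteral (i) (hi : i ∈ program) : i.literal < 2 ^ (b + N) :=
    (hb i hi).trans_le (Nat.pow_le_pow_right two_pos (Nat.le_add_right b N))
  rw [run_add]
  refine (hcheckpoint.run hliteral j).spaceLE.mono ?_
  simp only [spacePoly, Polynomial.eval_mul, Polynomial.eval_add, Polynomial.eval_C,
    Polynomial.eval_ofNat, Polynomial.eval_one]
  gcongr

theorem cast_card_irredundantSets_le (H : IndexedHypergraph (Fin n) (Fin m)) :
    ((H.irredundantSets Finset.univ Finset.univ).card : ℝ) ≤ 3 ^ (((n : ℝ) + (m : ℝ)) / 3) := by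
  have hbound := H.cardBound Finset.univ Finset.univ
  rw [CardBound, Finset.card_univ, Finset.card_univ, Fintype.card_fin, Fintype.card_fin,
    cbrtThree_pow] at hbound
  exact_mod_cast hbound

theorem cast_length_mul_period_le (H : IndexedHypergraph (Fin n) (Fin m)) :
    (((sortedSets H).length * period n m : ℕ) : ℝ) ≤
      ((periodPoly.eval (n + m) : ℕ) : ℝ) * 3 ^ (((n : ℝ) + (m : ℝ)) / 3) := by
  rw [mul_comm, Nat.cast_mul, length_sortedSets]
  gcongr
  exacts [period_le_eval_periodPoly n m, cast_card_irredundantSets_le H]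

theorem exists_program_enumeratesInTime :
    ∃ (P : Program) (time delay space : Polynomial ℕ),
      ∀ (n m : ℕ) (H : IndexedHypergraph (Fin n) (Fin m)), ∃ T : ℕ,
        EnumeratesInTime P H T ∧
        (T : ℝ) ≤ ((time.eval (n + m) : ℕ) : ℝ) * 3 ^ (((n : ℝ) + (m : ℝ)) / 3) ∧
        DelayLE P H T (delay.eval (n + m)) ∧
        ∀ t ≤ T, SpaceLE (run P (start H) t) (space.eval (n + m)) := by
  obtain ⟨b, hb⟩ := exists_forall_literal_lt program
  refine ⟨program, periodPoly, 2 * periodPoly, spacePoly b, fun n m H => ?_⟩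
  obtain ⟨T, hT, henum⟩ := exists_enumeratesInTime H
  have hdelay : 2 * period n m ≤ (2 * periodPoly).eval (n + m) := by
    rw [Polynomial.eval_mul, Polynomial.eval_ofNat]
    exact Nat.mul_le_mul_left 2 (period_le_eval_periodPoly n m)
  exact ⟨T, henum, (Nat.cast_le.2 hT).trans (cast_length_mul_period_le H), delayLE hT hdelay,
    fun t ht => spaceLE_run hb (ht.trans hT)⟩

/-- The hypergraph with `k` disjoint hyperedges of two vertices each, which has the largest
possible number of minimal Roman hitting sets. -/
def disjointPairs (k : ℕ) : IndexedHypergraph (Fin (2 * k)) (Fin k) where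
  edge i := Finset.univ.filter fun x => x.val / 2 = i.val

/-- The set of vertices that contains at most one vertex of each pair: the one with number `f i`
of the pair number `i` if `f i < 2`, and none if `f i = 2`. -/
def choiceSet {k : ℕ} (f : Fin k → Fin 3) : Finset (Fin (2 * k)) :=
  Finset.univ.filter fun x => x.val % 2 = f ⟨x.val / 2, by omega⟩

section Tightness

variable {k : ℕ} {f : Fin k → Fin 3}

theorem mem_disjointPairs_edge {i : Fin k} {x : Fin (2 * k)} :
    x ∈ (disjointPairs k).edge i ↔ x.val / 2 = i.val := by
  simp [disjointPairs]

theorem mem_choiceSet {x : Fin (2 * k)} :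
    x ∈ choiceSet f ↔ x.val % 2 = f ⟨x.val / 2, by omega⟩ := by
  simp [choiceSet]

theorem isIrredundant_choiceSet (f : Fin k → Fin 3) :
    (disjointPairs k).IsIrredundant Finset.univ (choiceSet f) := by
  intro x hx
  refine ⟨⟨x / 2, by omega⟩, Finset.mem_univ _, Finset.eq_singleton_iff_unique_mem.2
    ⟨Finset.mem_inter.2 ⟨mem_disjointPairs_edge.2 rfl, hx⟩, fun y hy => ?_⟩⟩
  obtain ⟨hedge, hy⟩ := Finset.mem_inter.1 hy
  have hdiv : y.val / 2 = x.val / 2 := mem_disjointPairs_edge.1 hedge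
  rw [mem_choiceSet] at hx hy
  simp only [hdiv] at hy
  exact Fin.ext (by omega)

theorem apply_eq_iff_mem_choiceSet {i : Fin k} {c : Fin 3} (hc : c.val < 2) :
    f i = c ↔ (⟨2 * i + c, by omega⟩ : Fin (2 * k)) ∈ choiceSet f := by
  have hdiv : (2 * i.val + c.val) / 2 = i := by omega
  have hmod : (2 * i.val + c.val) % 2 = c := by omega
  simp only [mem_choiceSet, hdiv, hmod, Fin.eta]
  rw [Fin.ext_iff, eq_comm]

theorem choiceSet_injective (k : ℕ) :
    Function.Injective (choiceSet : (Fin k → Fin 3) → Finset (Fin (2 * k))) := by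
  intro f g h
  funext i
  have hiff (c : Fin 3) (hc : c.val < 2) : f i = c ↔ g i = c := by
    rw [apply_eq_iff_mem_choiceSet hc, apply_eq_iff_mem_choiceSet hc, h]
  by_cases hf : (f i).val < 2
  · exact ((hiff _ hf).1 rfl).symm
  · by_cases hg : (g i).val < 2
    · exact (hiff _ hg).2 rfl
    · exact Fin.ext (by omega)

end Tightness

theorem three_rpow_two_mul_add_div_three (k : ℕ) :
    (3 : ℝ) ^ ((((2 * k : ℕ) : ℝ) + (k : ℝ)) / 3) = 3 ^ k := by
  rw [← Real.rpow_natCast]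
  congr 1
  push_cast
  ring

theorem ncard_isMinimalRomanHittingSet_disjointPairs (k : ℕ) :
    {R | (disjointPairs k).IsMinimalRomanHittingSet R}.ncard = 3 ^ k := by
  rw [ncard_setOf_isMinimalRomanHittingSet]
  apply le_antisymm
  · have hle := cast_card_irredundantSets_le (disjointPairs k)
    rw [three_rpow_two_mul_add_div_three] at hle
    exact_mod_cast hle
  · have hle := Finset.card_le_card_of_injOn (s := Finset.univ) choiceSet
      (fun f _ => mem_irredundantSets.2 ⟨Finset.subset_univ _, isIrredundant_choiceSet f⟩)
      (choiceSet_injective k).injOn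
    rwa [Finset.card_univ, Fintype.card_fun, Fintype.card_fin, Fintype.card_fin] at hle

theorem ncard_le_of_enumeratesInTime {P : Program} {T : ℕ} (h : EnumeratesInTime P H T) :
    {R | H.IsMinimalRomanHittingSet R}.ncard ≤ T := by
  obtain ⟨-, -, hmem⟩ := h
  have himage : encode '' {R | H.IsMinimalRomanHittingSet R} =
      ((run P (start H) T).out.toFinset : Set (List ℕ)) := by
    ext w
    simp only [Set.mem_image, Set.mem_ofPred_eq, List.coe_toFinset, hmem]
    exact exists_congr fun R => and_congr_right fun _ => eq_comm
  calc {R | H.IsMinimalRomanHittingSet R}.ncard = (run P (start H) T).out.toFinset.card := by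
        rw [← Set.ncard_image_of_injective _ encode_injective, himage, Set.ncard_coe_finset]
    _ ≤ (run P (start H) T).out.length := List.toFinset_card_le _
    _ ≤ (start H).out.length + T := out_length_run_le P (start H) T
    _ = T := Nat.zero_add T

end RomanEnum

theorem mainTheorem10 :
    (∃ (P : RAM.Program) (time delay space : Polynomial ℕ),
      ∀ (n m : ℕ) (H : IndexedHypergraph (Fin n) (Fin m)),
        ∃ T : ℕ,
          RomanEnum.EnumeratesInTime P H T ∧
          (T : ℝ) ≤ ((time.eval (n + m) : ℕ) : ℝ) * (3 : ℝ) ^ (((n : ℝ) + (m : ℝ)) / 3) ∧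
          RomanEnum.DelayLE P H T (delay.eval (n + m)) ∧
          ∀ t ≤ T, RAM.SpaceLE (RAM.run P (RomanEnum.start H) t) (space.eval (n + m))) ∧
    (∀ k : ℕ, ∃ (n m : ℕ) (H : IndexedHypergraph (Fin n) (Fin m)),
      n = 2 * k ∧ m = k ∧
      (({R | H.IsMinimalRomanHittingSet R} : Set (Finset (Fin m) × Finset (Fin n))).ncard : ℝ) =
        (3 : ℝ) ^ (((n : ℝ) + (m : ℝ)) / 3) ∧
      ∀ (P : RAM.Program) (T : ℕ), RomanEnum.EnumeratesInTime P H T →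
        (3 : ℝ) ^ (((n : ℝ) + (m : ℝ)) / 3) ≤ (T : ℝ)) := by
  refine ⟨RomanEnum.exists_program_enumeratesInTime, fun k =>
    ⟨2 * k, k, RomanEnum.disjointPairs k, rfl, rfl, ?_, fun P T hT => ?_⟩⟩
  · rw [RomanEnum.ncard_isMinimalRomanHittingSet_disjointPairs,
      RomanEnum.three_rpow_two_mul_add_div_three, Nat.cast_pow, Nat.cast_ofNat]
  · have hle := RomanEnum.ncard_le_of_enumeratesInTime hT
    rw [RomanEnum.ncard_isMinimalRomanHittingSet_disjointPairs] at hle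
    rw [RomanEnum.three_rpow_two_mul_add_div_three]
    exact_mod_cast hle
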